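/- Let $\theta=(\theta_1,\theta_2)\in\mathbb R^2$ with $\delta=\theta_1/\theta_2\in\mathbb R\setminus\mathbb Q$, and let $\mu_p,\rho_p:\mathbb R^2\to\mathbb R$ be continuous and $1$-periodic in each variable. Assume that there are constants $\mu_-,\rho_->0$ with $\mu_p(x\theta)\ge\mu_-$ and $\rho_p(x\theta)\ge\rho_-$ for all $x\in\mathbb R$. Let $D_\theta=\theta_1\partial_{y_1}+\theta_2\partial_{y_2}$ in the sense of distributions on $\mathbb R^2$. Let $L^2_{per}$ be the Hilbert space of functions on $\mathbb R^2$ that are $1$-periodic in $y_1$ and square integrable on $(0,1)\times\mathbb R$, let $L^2_{per,2}$ be the Hilbert space of functions that are $1$-periodic in $y_1$ and in $y_2$ and square integrable on $(0,1)^2$, and set $$H^1_{\theta,per}=\{U\in L^2_{per}: D_\theta U\in L^2_{per}\},\qquad H^1_{\theta,per,2}=\{U\in L^2_{per,2}: D_\theta U\in L^2_{per,2}\}.$$ Consider the unbounded operator in $L^2_{per}$ $$D(\mathcal A_p)=\{U\in H^1_{\theta,per}:\ \mu_pD_\theta U\in H^1_{\theta,per}\},\qquad \mathcal A_pU=-\rho_p^{-1}D_\theta(\mu_pD_\theta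 U),$$ and, for $\xi\in\mathbb R$, the unbounded operator in $L^2_{per,2}$ $$D(\mathcal A_p(\xi))=\{U\in H^1_{\theta,per,2}:\ \mu_p(D_\theta+i\xi\theta_2)U\in H^1_{\theta,per,2}\},\qquad \mathcal A_p(\xi)U=-\rho_p^{-1}(D_\theta+i\xi\theta_2)\big(\mu_p(D_\theta+i\xi\theta_2)U\big).$$ The spectrum $\sigma(A)$ of an unbounded operator $A$ is the set of $z\in\mathbb C$ for which $A-z$ is not a bijection from its domain onto the whole space with bounded inverse. Then $\sigma(\mathcal A_p(\xi))$ does not depend on $\xi\in\mathbb R$, and $\sigma(\mathcal A_p)=\sigma(\mathcal A_p(\xi))$ for every $\xi\in\mathbb R$. -/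

import Mathlib

open MeasureTheory Set Filter Topology
open scoped ContDiff

noncomputable section

namespace QuasiPeriodic

/-- The two kinds of periodicity used below for functions on `ℝ × ℝ`: `first` means 1-periodic
in `y₁` only, `both` means 1-periodic in `y₁` and in `y₂`. -/
inductive Periodicity where
  | first
  | both

/-- The periodicity cell: `[0,1) × ℝ` for functions that are periodic in `y₁`, and `[0,1)²` for
doubly periodic functions. -/
def cell : Periodicity → Set (ℝ × ℝ)
  | .first => Ico 0 1 ×ˢ univ
  | .both => Ico 0 1 ×ˢ Ico 0 1

/-- The integer translation that brings a point back to the periodicity cell. -/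
def shift : Periodicity → ℝ × ℝ → ℤ × ℤ
  | .first, y => (⌊y.1⌋, 0)
  | .both, y => (⌊y.1⌋, ⌊y.2⌋)

/-- The representative in the periodicity cell of a point of the plane. -/
def fold (p : Periodicity) (y : ℝ × ℝ) : ℝ × ℝ :=
  y - (((shift p y).1 : ℝ), ((shift p y).2 : ℝ))

/-- The Hilbert space of periodic functions (in the sense of `p`) that are square integrable on
the periodicity cell, identified with `L²(cell)` by restriction. -/
abbrev L2per (p : Periodicity) : Type :=
  Lp ℂ 2 ((volume : Measure (ℝ × ℝ)).restrict (cell p))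

/-- The periodic extension to the plane of (a representative of) an element of `L2per p`. -/
def perExt (p : Periodicity) (U : L2per p) : ℝ × ℝ → ℂ := fun y => U (fold p y)

/-- `W = θ₁ ∂₁U + θ₂ ∂₂U` in the sense of distributions on the plane. -/
def HasWeakDirDeriv (θ : ℝ × ℝ) (U W : ℝ × ℝ → ℂ) : Prop :=
  ∀ φ : ℝ × ℝ → ℂ, ContDiff ℝ ∞ φ → HasCompactSupport φ →
    ∫ y, U y * fderiv ℝ φ y θ = - ∫ y, W y * φ y

lemma fold_mem_cell (p : Periodicity) (y : ℝ × ℝ) : fold p y ∈ cell p := by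
  cases p
  · simp [fold, shift, cell, Int.fract_nonneg, Int.fract_lt_one]
  · simp [fold, shift, cell, Int.fract_nonneg, Int.fract_lt_one]

lemma fold_eq_self (p : Periodicity) {y : ℝ × ℝ} (hy : y ∈ cell p) : fold p y = y := by
  cases p
  · have h1 : ⌊y.1⌋ = 0 := Int.floor_eq_zero_iff.2 hy.1
    ext <;> simp [fold, shift, h1]
  · have h1 : ⌊y.1⌋ = 0 := Int.floor_eq_zero_iff.2 hy.1
    have h2 : ⌊y.2⌋ = 0 := Int.floor_eq_zero_iff.2 hy.2
    ext <;> simp [fold, shift, h1, h2]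

lemma measurableSet_cell (p : Periodicity) : MeasurableSet (cell p) := by
  cases p
  · exact measurableSet_Ico.prod MeasurableSet.univ
  · exact measurableSet_Ico.prod measurableSet_Ico

lemma measurable_shift (p : Periodicity) : Measurable (shift p) := by
  cases p
  · exact (Int.measurable_floor.comp measurable_fst).prodMk measurable_const
  · exact (Int.measurable_floor.comp measurable_fst).prodMk
      (Int.measurable_floor.comp measurable_snd)

lemma measurable_fold (p : Periodicity) : Measurable (fold p) := by
  have h : Measurable fun n : ℤ × ℤ => ((n.1 : ℝ), (n.2 : ℝ)) := Measurable.of_discrete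
  exact measurable_id.sub (h.comp (measurable_shift p))

/-- The plane is covered by the countably many sets on which `fold` is a fixed translation. -/
lemma quasiMeasurePreserving_fold (p : Periodicity) :
    Measure.QuasiMeasurePreserving (fold p) volume
      ((volume : Measure (ℝ × ℝ)).restrict (cell p)) := by
  refine ⟨measurable_fold p, Measure.AbsolutelyContinuous.mk fun s hs h0 => ?_⟩
  rw [Measure.map_apply (measurable_fold p) hs]
  rw [Measure.restrict_apply hs] at h0
  have hsub : fold p ⁻¹' s ⊆
      ⋃ n : ℤ × ℤ, (fun y : ℝ × ℝ => y - ((n.1 : ℝ), (n.2 : ℝ))) ⁻¹' (s ∩ cell p) := by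
    intro y hy
    exact mem_iUnion.2 ⟨shift p y, hy, fold_mem_cell p y⟩
  refine measure_mono_null hsub (measure_iUnion_null fun n => ?_)
  rw [(measurePreserving_sub_right volume ((n.1 : ℝ), (n.2 : ℝ))).measure_preimage
    (hs.inter (measurableSet_cell p)).nullMeasurableSet]
  exact h0

lemma locallyIntegrable_perExt (p : Periodicity) (U : L2per p) :
    LocallyIntegrable (perExt p U) volume := by
  rw [locallyIntegrable_iff]
  intro K hK
  obtain ⟨r, hr⟩ := hK.isBounded.subset_closedBall (0 : ℝ × ℝ)
  obtain ⟨N, hN⟩ := exists_nat_gt r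
  set S : Set (ℤ × ℤ) := Icc (-(N : ℤ) - 1) N ×ˢ Icc (-(N : ℤ) - 1) N with hS
  have hSfin : S.Finite := (finite_Icc _ _).prod (finite_Icc _ _)
  have hfl : ∀ x : ℝ, |x| ≤ r → ⌊x⌋ ∈ Icc (-(N : ℤ) - 1) N := by
    intro x hx
    have := abs_le.1 hx
    refine ⟨Int.le_floor.2 ?_, ?_⟩
    · push_cast; linarith
    · have h1 : (⌊x⌋ : ℝ) ≤ x := Int.floor_le x
      have h2 : (⌊x⌋ : ℝ) ≤ ((N : ℤ) : ℝ) := by push_cast; linarith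
      exact_mod_cast h2
  have hcov : K ⊆ ⋃ n ∈ S, (K ∩ shift p ⁻¹' {n}) := by
    intro y hy
    have hy' : ‖y‖ ≤ r := by simpa using hr hy
    have h1 : |y.1| ≤ r := (norm_fst_le y).trans hy'
    have h2 : |y.2| ≤ r := (norm_snd_le y).trans hy'
    refine mem_iUnion₂.2 ⟨shift p y, ?_, hy, rfl⟩
    cases p
    · refine ⟨hfl _ h1, ?_⟩
      simp only [shift, mem_Icc]
      omega
    · exact ⟨hfl _ h1, hfl _ h2⟩
  refine IntegrableOn.mono_set ?_ hcov
  refine (integrableOn_finite_biUnion hSfin).2 fun n _ => ?_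
  set v : ℝ × ℝ := ((n.1 : ℝ), (n.2 : ℝ)) with hv
  have hKm : MeasurableSet (K ∩ shift p ⁻¹' {n}) :=
    hK.measurableSet.inter (measurable_shift p (measurableSet_singleton n))
  -- on this set the extension is a translate of `U`
  have heq : EqOn (perExt p U) (fun y => U (y - v)) (K ∩ shift p ⁻¹' {n}) := by
    rintro y ⟨_, hy⟩
    have : shift p y = n := hy
    simp only [perExt, fold, this, hv]
  rw [integrableOn_congr_fun heq hKm]
  have hm : MemLp (fun y => U (y - v)) 2
      (volume.restrict ((fun y : ℝ × ℝ => y - v) ⁻¹' cell p)) :=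
    (Lp.memLp U).comp_measurePreserving
      ((measurePreserving_sub_right volume v).restrict_preimage (measurableSet_cell p))
  have hsub : K ∩ shift p ⁻¹' {n} ⊆ (fun y : ℝ × ℝ => y - v) ⁻¹' cell p := by
    rintro y ⟨_, hy⟩
    have h1 : shift p y = n := hy
    have h2 := fold_mem_cell p y
    simp only [fold, h1] at h2
    exact h2
  have hm' : MemLp (fun y => U (y - v)) 2 (volume.restrict (K ∩ shift p ⁻¹' {n})) :=
    hm.mono_measure (Measure.restrict_mono hsub le_rfl)
  have : IsFiniteMeasure ((volume : Measure (ℝ × ℝ)).restrict (K ∩ shift p ⁻¹' {n})) :=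
    ⟨by simpa using (measure_mono inter_subset_left).trans_lt hK.measure_lt_top⟩
  exact hm'.integrable (by norm_num)

lemma perExt_add (p : Periodicity) (U V : L2per p) :
    perExt p (U + V) =ᵐ[volume] fun y => perExt p U y + perExt p V y :=
  (quasiMeasurePreserving_fold p).ae (Lp.coeFn_add U V)

lemma perExt_smul (p : Periodicity) (c : ℂ) (U : L2per p) :
    perExt p (c • U) =ᵐ[volume] fun y => c * perExt p U y :=
  (quasiMeasurePreserving_fold p).ae (Lp.coeFn_smul c U)

lemma perExt_zero (p : Periodicity) : perExt p (0 : L2per p) =ᵐ[volume] fun _ => 0 :=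
  (quasiMeasurePreserving_fold p).ae (Lp.coeFn_zero ℂ 2 _)

lemma eq_of_perExt_ae_eq (p : Periodicity) {U V : L2per p}
    (h : perExt p U =ᵐ[volume] perExt p V) : U = V := by
  refine Lp.ext ?_
  filter_upwards [ae_restrict_of_ae h, ae_restrict_mem (measurableSet_cell p)] with y hy hc
  simpa only [perExt, fold_eq_self p hc] using hy

/-- `U` belongs to the periodic directional Sobolev space, and its weak directional derivative
`D_θ U` is `W`. -/
def HasD (p : Periodicity) (θ : ℝ × ℝ) (U W : L2per p) : Prop :=
  HasWeakDirDeriv θ (perExt p U) (perExt p W)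

lemma integrable_perExt_mul (p : Periodicity) (U : L2per p) {g : ℝ × ℝ → ℂ}
    (hg : Continuous g) (hs : HasCompactSupport g) :
    Integrable (fun y => perExt p U y * g y) volume := by
  have h := (locallyIntegrable_perExt p U).integrable_smul_left_of_hasCompactSupport hg hs
  refine h.congr (Eventually.of_forall fun y => ?_)
  simp [mul_comm]

lemma HasD.add {p : Periodicity} {θ : ℝ × ℝ} {U W U' W' : L2per p} (h : HasD p θ U W)
    (h' : HasD p θ U' W') : HasD p θ (U + U') (W + W') := by
  intro φ hφ hs
  have hd : Continuous fun y => fderiv ℝ φ y θ :=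
    (hφ.continuous_fderiv (by simp)).clm_apply continuous_const
  have hds : HasCompactSupport fun y => fderiv ℝ φ y θ := hs.fderiv_apply ℝ θ
  have e1 : ∫ y, perExt p (U + U') y * fderiv ℝ φ y θ =
      ∫ y, (perExt p U y * fderiv ℝ φ y θ + perExt p U' y * fderiv ℝ φ y θ) :=
    integral_congr_ae (by filter_upwards [perExt_add p U U'] with y hy; rw [hy, add_mul])
  have e2 : ∫ y, perExt p (W + W') y * φ y =
      ∫ y, (perExt p W y * φ y + perExt p W' y * φ y) :=
    integral_congr_ae (by filter_upwards [perExt_add p W W'] with y hy; rw [hy, add_mul])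
  rw [e1, e2, integral_add (integrable_perExt_mul p U hd hds) (integrable_perExt_mul p U' hd hds),
    integral_add (integrable_perExt_mul p W hφ.continuous hs)
      (integrable_perExt_mul p W' hφ.continuous hs), h φ hφ hs, h' φ hφ hs]
  ring

lemma HasD.smul {p : Periodicity} {θ : ℝ × ℝ} {U W : L2per p} (c : ℂ) (h : HasD p θ U W) :
    HasD p θ (c • U) (c • W) := by
  intro φ hφ hs
  have e1 : ∫ y, perExt p (c • U) y * fderiv ℝ φ y θ =
      ∫ y, c * (perExt p U y * fderiv ℝ φ y θ) :=
    integral_congr_ae (by filter_upwards [perExt_smul p c U] with y hy; rw [hy, mul_assoc])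
  have e2 : ∫ y, perExt p (c • W) y * φ y = ∫ y, c * (perExt p W y * φ y) :=
    integral_congr_ae (by filter_upwards [perExt_smul p c W] with y hy; rw [hy, mul_assoc])
  rw [e1, e2, integral_const_mul, integral_const_mul, h φ hφ hs]
  ring

lemma HasD.zero (p : Periodicity) (θ : ℝ × ℝ) : HasD p θ 0 0 := by
  have h : ∀ g : ℝ × ℝ → ℂ, ∫ y, perExt p 0 y * g y = 0 := fun g => by
    rw [integral_congr_ae (g := fun _ => (0 : ℂ))
      (by filter_upwards [perExt_zero p] with y hy; rw [hy, zero_mul]), integral_zero]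
  intro φ _ _
  rw [h, h, neg_zero]

/-- Weak directional derivatives are unique. -/
lemma HasD.eq_zero {p : Periodicity} {θ : ℝ × ℝ} {W : L2per p} (h : HasD p θ 0 W) : W = 0 := by
  refine eq_of_perExt_ae_eq p ?_
  have h0 : ∀ᵐ y, perExt p W y = 0 := by
    refine ae_eq_zero_of_integral_contDiff_smul_eq_zero (locallyIntegrable_perExt p W) ?_
    intro g hg hgs
    have hφ : ContDiff ℝ ∞ fun y => (g y : ℂ) := Complex.ofRealCLM.contDiff.comp hg
    have hφs : HasCompactSupport fun y => (g y : ℂ) :=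
      hgs.comp_left (g := fun x : ℝ => (x : ℂ)) Complex.ofReal_zero
    have e := h _ hφ hφs
    rw [integral_congr_ae (g := fun _ => (0 : ℂ))
      (by filter_upwards [perExt_zero p] with y hy; rw [hy, zero_mul]), integral_zero] at e
    have e' : ∫ y, perExt p W y * (g y : ℂ) = 0 := neg_eq_zero.1 e.symm
    rw [← e']
    refine integral_congr_ae (Eventually.of_forall fun y => ?_)
    simp [mul_comm]
  filter_upwards [h0, perExt_zero p] with y h1 h2
  rw [h1, h2]

/-- The graph of `U ↦ -ρ⁻¹ (D_θ + κ) μ (D_θ + κ) U`: in the notation below `W = D_θ U`,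
`P = μ (D_θ + κ) U` and `Q = D_θ P`, all of them square integrable on the cell. Thus `U` is in the
domain iff `U` and `μ (D_θ + κ) U` both belong to the periodic directional Sobolev space and
the resulting function is in `L²`. -/
def opGraph (p : Periodicity) (θ : ℝ × ℝ) (μ ρ : ℝ × ℝ → ℝ) (κ : ℂ) :
    Submodule ℂ (L2per p × L2per p) where
  carrier := {UF | ∃ W P Q : L2per p,
    HasD p θ UF.1 W ∧
    (∀ᵐ y ∂(volume : Measure (ℝ × ℝ)).restrict (cell p),
      P y = (μ y : ℂ) * (W y + κ * UF.1 y)) ∧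
    HasD p θ P Q ∧
    (∀ᵐ y ∂(volume : Measure (ℝ × ℝ)).restrict (cell p),
      UF.2 y = -((ρ y : ℂ)⁻¹ * (Q y + κ * P y)))}
  add_mem' := by
    rintro ⟨U, F⟩ ⟨U', F'⟩ ⟨W, P, Q, h1, h2, h3, h4⟩ ⟨W', P', Q', h1', h2', h3', h4'⟩
    refine ⟨W + W', P + P', Q + Q', h1.add h1', ?_, h3.add h3', ?_⟩
    · filter_upwards [h2, h2', Lp.coeFn_add P P', Lp.coeFn_add W W', Lp.coeFn_add U U']
        with y a a' b c d
      simp only [Prod.mk_add_mk, b, c, d, Pi.add_apply, a, a']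
      ring
    · filter_upwards [h4, h4', Lp.coeFn_add P P', Lp.coeFn_add Q Q', Lp.coeFn_add F F']
        with y a a' b c d
      simp only [Prod.mk_add_mk, b, c, d, Pi.add_apply] at a a' ⊢
      rw [a, a']
      ring
  zero_mem' := by
    refine ⟨0, 0, 0, HasD.zero p θ, ?_, HasD.zero p θ, ?_⟩
    · filter_upwards [Lp.coeFn_zero ℂ 2 ((volume : Measure (ℝ × ℝ)).restrict (cell p))] with y a
      change (0 : L2per p) y = (μ y : ℂ) * ((0 : L2per p) y + κ * (0 : L2per p) y)
      rw [a]
      simp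
    · filter_upwards [Lp.coeFn_zero ℂ 2 ((volume : Measure (ℝ × ℝ)).restrict (cell p))] with y a
      change (0 : L2per p) y = -((ρ y : ℂ)⁻¹ * ((0 : L2per p) y + κ * (0 : L2per p) y))
      rw [a]
      simp
  smul_mem' := by
    rintro c ⟨U, F⟩ ⟨W, P, Q, h1, h2, h3, h4⟩
    refine ⟨c • W, c • P, c • Q, h1.smul c, ?_, h3.smul c, ?_⟩
    · filter_upwards [h2, Lp.coeFn_smul c P, Lp.coeFn_smul c W, Lp.coeFn_smul c U]
        with y a b d e
      simp only [Prod.smul_mk, b, d, e, Pi.smul_apply, smul_eq_mul, a]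
      ring
    · filter_upwards [h4, Lp.coeFn_smul c P, Lp.coeFn_smul c Q, Lp.coeFn_smul c F]
        with y a b d e
      simp only [Prod.smul_mk, b, d, e, Pi.smul_apply, smul_eq_mul] at a ⊢
      rw [a]
      ring

lemma opGraph_functional (p : Periodicity) (θ : ℝ × ℝ) (μ ρ : ℝ × ℝ → ℝ) (κ : ℂ)
    (x : L2per p × L2per p) (hx : x ∈ opGraph p θ μ ρ κ) (hx0 : x.1 = 0) : x.2 = 0 := by
  obtain ⟨U, F⟩ := x
  obtain ⟨W, P, Q, h1, h2, h3, h4⟩ := hx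
  simp only at hx0
  subst hx0
  have hW : W = 0 := h1.eq_zero
  subst hW
  have hz := Lp.coeFn_zero ℂ 2 ((volume : Measure (ℝ × ℝ)).restrict (cell p))
  have hP : P = 0 := by
    refine Lp.ext ?_
    filter_upwards [h2, hz] with y a b
    rw [a, b]
    simp
  subst hP
  have hQ : Q = 0 := h3.eq_zero
  subst hQ
  refine Lp.ext ?_
  filter_upwards [h4, hz] with y a b
  rw [a, b]
  simp

/-- The unbounded operator `U ↦ -ρ⁻¹ (D_θ + κ) μ (D_θ + κ) U` in `L2per p`. -/
def op (p : Periodicity) (θ : ℝ × ℝ) (μ ρ : ℝ × ℝ → ℝ) (κ : ℂ) : L2per p →ₗ.[ℂ] L2per p :=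
  (opGraph p θ μ ρ κ).toLinearPMap

lemma graph_op (p : Periodicity) (θ : ℝ × ℝ) (μ ρ : ℝ × ℝ → ℝ) (κ : ℂ) :
    (op p θ μ ρ κ).graph = opGraph p θ μ ρ κ :=
  Submodule.toLinearPMap_graph_eq _ (opGraph_functional p θ μ ρ κ)

/-- The operator `A_p U = -ρ⁻¹ D_θ (μ D_θ U)` on functions that are 1-periodic in `y₁` and square
integrable on `(0,1) × ℝ`. -/
def opA (θ : ℝ × ℝ) (μ ρ : ℝ × ℝ → ℝ) : L2per .first →ₗ.[ℂ] L2per .first :=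
  op .first θ μ ρ 0

/-- The Floquet–Bloch fiber `A_p(ξ) U = -ρ⁻¹ (D_θ + iξθ₂) μ (D_θ + iξθ₂) U` on doubly periodic
functions. -/
def opAFiber (θ : ℝ × ℝ) (μ ρ : ℝ × ℝ → ℝ) (ξ : ℝ) : L2per .both →ₗ.[ℂ] L2per .both :=
  op .both θ μ ρ (Complex.I * ξ * θ.2)

/-- The resolvent set of an unbounded operator `A`: the complex `z` such that `A - z` is a
bijection from the domain of `A` onto the whole space, with bounded inverse `R`. -/
def resolventSetOp {H : Type*} [NormedAddCommGroup H] [NormedSpace ℂ H] (A : H →ₗ.[ℂ] H) :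
    Set ℂ :=
  {z | ∃ R : H →L[ℂ] H,
    (∀ f : H, ∃ h : R f ∈ A.domain, A ⟨R f, h⟩ - z • R f = f) ∧
    ∀ u : A.domain, R (A u - z • (u : H)) = u}

/-- The spectrum of an unbounded operator. -/
def spectrumOp {H : Type*} [NormedAddCommGroup H] [NormedSpace ℂ H] (A : H →ₗ.[ℂ] H) : Set ℂ :=
  (resolventSetOp A)ᶜ

end QuasiPeriodic

end

/-! Write m = μ⁻¹, r = ρ and p = μ (D_θ + κ) u. The resolvent equation (A - z) u = f then becomes
the first order system (D_θ + κ) u - m p = 0, (D_θ + κ) p + z r u = -r f. The coefficients now enter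
only as bounded multiplication operators, and for imaginary κ the differential part is skew-adjoint
for both kinds of periodicity (`isSkewAdjointRel_hasD`).

By `mem_resolventSetOp_iff_systemBound`, z is in the resolvent set exactly when the system is
bounded below for z and for its conjugate. A lower bound makes the range closed; the orthogonal
complement of the range is the kernel of the adjoint system, which after swapping the two components
is the system for the conjugate of z. In the other direction, a resolvent at z is turned into a
lower bound by comparison with the parameter -1, where the system is always invertible because m and
r are positive.

What remains is to transfer lower bounds (`SystemBound`) between the operators. On the torus,
multiplication by a doubly periodic character is unitary, commutes with the coefficients and changes
κ by 2πi(kθ₁ + lθ₂). These shifts are dense in iℝ since θ₁/θ₂ is irrational, and the bound is a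
closed condition in κ, so it holds for every imaginary κ with the same constant
(`SystemBound.of_irrational`). From the cylinder to the torus, a doubly periodic function is cut off
at |y₂| ~ N. Its squared norm is of order N times that on the unit cell, and the derivative of the
cutoff contributes a factor 1/N, which is absorbed for large N (`SystemBound.both_of_first`). From
the torus to the cylinder, a function supported in -N ≤ y₂ < N is decomposed by a discrete Bloch
transform with 2N quasi-momenta. Each component is doubly periodic and obeys the fiber bound with
one common constant; the finite Plancherel identity adds these bounds up, and a cutoff with N → ∞
removes the support condition (`SystemBound.first_of_both`). -/

noncomputable section

namespace QuasiPeriodic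

open scoped BoundedContinuousFunction

/-! ### Skew-adjoint relations and their bounded perturbations -/

section SkewAdjoint

variable {E : Type*} [NormedAddCommGroup E] [InnerProductSpace ℂ E]

/-- A linear relation (the graph of an unbounded operator) that is its own negative adjoint. -/
def IsSkewAdjointRel (D : E → E → Prop) : Prop :=
  ∀ x y, D x y ↔ ∀ p q, D p q → inner ℂ p y = -inner ℂ q x

lemma IsSkewAdjointRel.add {D : E → E → Prop} (hD : IsSkewAdjointRel D) {x y x' y' : E}
    (h : D x y) (h' : D x' y') : D (x + x') (y + y') := by
  rw [hD] at h h' ⊢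
  intro p q hpq
  rw [inner_add_right, inner_add_right, h p q hpq, h' p q hpq]
  ring

lemma IsSkewAdjointRel.smul {D : E → E → Prop} (hD : IsSkewAdjointRel D) {x y : E} (c : ℂ)
    (h : D x y) : D (c • x) (c • y) := by
  rw [hD] at h ⊢
  intro p q hpq
  rw [inner_smul_right, inner_smul_right, h p q hpq]
  ring

lemma IsSkewAdjointRel.zero {D : E → E → Prop} (hD : IsSkewAdjointRel D) : D 0 0 := by
  rw [hD]
  intro p q _
  simp

lemma IsSkewAdjointRel.neg {D : E → E → Prop} (hD : IsSkewAdjointRel D) {x y : E}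
    (h : D x y) : D (-x) (-y) := by
  simpa using hD.smul (-1) h

lemma IsSkewAdjointRel.sub {D : E → E → Prop} (hD : IsSkewAdjointRel D) {x y x' y' : E}
    (h : D x y) (h' : D x' y') : D (x - x') (y - y') := by
  simpa [sub_eq_add_neg] using hD.add h (hD.neg h')

/-- An adjoint has a closed graph: membership is a family of equations, each continuous in the pair.
-/
lemma IsSkewAdjointRel.of_tendsto {D : E → E → Prop} (hD : IsSkewAdjointRel D)
    {u v : ℕ → E} {x y : E} (h : ∀ n, D (u n) (v n)) (hu : Tendsto u atTop (𝓝 x))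
    (hv : Tendsto v atTop (𝓝 y)) : D x y := by
  rw [hD]
  intro p q hpq
  refine tendsto_nhds_unique (tendsto_const_nhds.inner (𝕜 := ℂ) hv) ?_
  refine (tendsto_const_nhds.inner (𝕜 := ℂ) hu).neg.congr fun n => ?_
  exact ((hD _ _).1 (h n) p q hpq).symm

variable [CompleteSpace E]

/-- A bounded perturbation of a skew-adjoint operator that is bounded below and whose adjoint is
injective is surjective. -/
lemma IsSkewAdjointRel.surjective_add {D : E → E → Prop} (hD : IsSkewAdjointRel D)
    (B : E →L[ℂ] E) {c : ℝ} (hc : 0 < c) (hB : ∀ x y, D x y → c * ‖x‖ ≤ ‖y + B x‖)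
    (hinj : ∀ x, D x (B.adjoint x) → x = 0) (f : E) : ∃ x y, D x y ∧ y + B x = f := by
  let R : Submodule ℂ E :=
    { carrier := {f | ∃ x y, D x y ∧ y + B x = f}
      add_mem' := by
        rintro _ _ ⟨x, y, h, rfl⟩ ⟨x', y', h', rfl⟩
        exact ⟨x + x', y + y', hD.add h h', by rw [map_add]; abel⟩
      zero_mem' := ⟨0, 0, hD.zero, by simp⟩
      smul_mem' := by
        rintro a _ ⟨x, y, h, rfl⟩
        exact ⟨a • x, a • y, hD.smul a h, by simp⟩ }
  have hcl : IsClosed (R : Set E) := by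
    refine IsSeqClosed.isClosed ?_
    intro g f hg hgf
    choose x y hxy hf using hg
    have hx : CauchySeq x := by
      have h1 := hgf.cauchySeq
      rw [Metric.cauchySeq_iff] at h1 ⊢
      intro ε hε
      obtain ⟨N, hN⟩ := h1 (c * ε) (by positivity)
      refine ⟨N, fun m hm n hn => ?_⟩
      have h2 := hB _ _ (hD.sub (hxy m) (hxy n))
      have h3 : y m - y n + B (x m - x n) = g m - g n := by
        rw [← hf m, ← hf n, map_sub]; abel
      have h4 := hN m hm n hn
      rw [dist_eq_norm] at h4 ⊢
      rw [h3] at h2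
      exact lt_of_mul_lt_mul_left (h2.trans_lt h4) hc.le
    obtain ⟨x', hx'⟩ := cauchySeq_tendsto_of_complete hx
    have hy : Tendsto y atTop (𝓝 (f - B x')) := by
      refine (hgf.sub ((B.continuous.tendsto x').comp hx')).congr fun n => ?_
      simp [← hf n]
    exact ⟨x', f - B x', hD.of_tendsto hxy hx' hy, by simp⟩
  have hRc : R.topologicalClosure = R := hcl.submodule_topologicalClosure_eq
  have : R = ⊤ := by
    rw [← hRc, Submodule.topologicalClosure_eq_top_iff, Submodule.eq_bot_iff]
    intro x hx
    -- Orthogonality of x to every q + B p with D p q says that x is in the domain of the adjoint of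
    -- D, which by skew-adjointness reads D x = B* x.
    refine hinj x ((hD _ _).2 fun p q hpq => ?_)
    have h1 := (Submodule.mem_orthogonal _ _).1 hx (q + B p) ⟨p, q, hpq, rfl⟩
    rw [inner_add_left] at h1
    rw [ContinuousLinearMap.adjoint_inner_right]
    linear_combination h1
  exact (this ▸ Submodule.mem_top : f ∈ R)

omit [CompleteSpace E] in
/-- The bounded inverse of a bounded perturbation of a skew-adjoint operator. -/
lemma IsSkewAdjointRel.exists_inverse {D : E → E → Prop} (hD : IsSkewAdjointRel D)
    (B : E →L[ℂ] E) {c : ℝ} (hc : 0 < c) (hB : ∀ x y, D x y → c * ‖x‖ ≤ ‖y + B x‖)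
    (hs : ∀ f, ∃ x y, D x y ∧ y + B x = f) :
    ∃ S : E →L[ℂ] E, ∀ f, D (S f) (f - B (S f)) := by
  choose x y hxy hf using hs
  have hy : ∀ f, D (x f) (f - B (x f)) := fun f => by
    have : y f = f - B (x f) := eq_sub_of_add_eq (hf f)
    exact this ▸ hxy f
  have huniq : ∀ f u, D u (f - B u) → u = x f := fun f u hu => by
    have h1 := hB _ _ (hD.sub hu (hy f))
    have h2 : f - B u - (f - B (x f)) + B (u - x f) = 0 := by rw [map_sub]; abel
    rw [h2, norm_zero] at h1
    have h3 : ‖u - x f‖ ≤ 0 := by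
      by_contra h
      push Not at h
      nlinarith
    exact sub_eq_zero.1 (norm_le_zero_iff.1 h3)
  let S : E →ₗ[ℂ] E :=
    { toFun := x
      map_add' := fun f g => by
        refine (huniq _ _ ?_).symm
        convert hD.add (hy f) (hy g) using 1
        rw [map_add]; abel
      map_smul' := fun a f => by
        refine (huniq _ _ ?_).symm
        change D (a • x f) (a • f - B (a • x f))
        rw [map_smul, ← smul_sub]
        exact hD.smul a (hy f) }
  refine ⟨S.mkContinuous c⁻¹ fun f => ?_, fun f => hy f⟩
  have h1 := hB _ _ (hy f)
  rw [sub_add_cancel] at h1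
  rw [inv_mul_eq_div, le_div_iff₀' hc]
  exact h1

/-- The adjoint of D + B is -(D - B*). Solving (D + B) u = x gives ‖x‖² = -⟨u, y - B* x⟩ with c ‖u‖
≤ ‖x‖, and Cauchy-Schwarz passes the constant c to the adjoint. -/
lemma IsSkewAdjointRel.adjoint_bound {D : E → E → Prop} (hD : IsSkewAdjointRel D)
    (B : E →L[ℂ] E) {c : ℝ} (hc : 0 < c) (hB : ∀ x y, D x y → c * ‖x‖ ≤ ‖y + B x‖)
    (hs : ∀ f, ∃ x y, D x y ∧ y + B x = f) {x y : E} (h : D x y) :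
    c * ‖x‖ ≤ ‖y - B.adjoint x‖ := by
  obtain ⟨u, v, huv, hx⟩ := hs x
  have h1 := (hD _ _).1 h u v huv
  have h2 : inner ℂ x x = -inner ℂ u (y - B.adjoint x) := by
    conv_lhs => rw [← hx]
    rw [inner_add_left, inner_sub_right, ContinuousLinearMap.adjoint_inner_right, hx]
    linear_combination h1
  have h3 : ‖x‖ ^ 2 ≤ ‖u‖ * ‖y - B.adjoint x‖ := by
    have := norm_inner_le_norm (𝕜 := ℂ) u (y - B.adjoint x)
    rw [← norm_neg, ← h2, inner_self_eq_norm_sq_to_K] at this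
    simpa using this
  have h4 := hB _ _ huv
  rw [hx] at h4
  rcases (norm_nonneg x).eq_or_lt with h0 | h0
  · rw [← h0, mul_zero]; exact norm_nonneg _
  · have h5 : c * ‖x‖ ^ 2 ≤ ‖x‖ * ‖y - B.adjoint x‖ := by
      calc c * ‖x‖ ^ 2 ≤ c * (‖u‖ * ‖y - B.adjoint x‖) := by gcongr
        _ = c * ‖u‖ * ‖y - B.adjoint x‖ := by ring
        _ ≤ _ := by gcongr
    nlinarith

end SkewAdjoint

/-! ### The first order system -/

section System

variable {H : Type*} [NormedAddCommGroup H] [InnerProductSpace ℂ H]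

/-- The skew-adjoint operator `D + κ` acting on pairs. -/
def pairRel (D : H → H → Prop) (κ : ℂ) (x y : WithLp 2 (H × H)) : Prop :=
  D x.fst (y.fst - κ • x.fst) ∧ D x.snd (y.snd - κ • x.snd)

/-- An imaginary multiple of the identity is itself skew-adjoint, and the two components decouple,
as testing with pairs (p, 0) and (0, p) shows. -/
lemma IsSkewAdjointRel.pairRel {D : H → H → Prop} (hD : IsSkewAdjointRel D) {κ : ℂ}
    (hκ : starRingEnd ℂ κ = -κ) : IsSkewAdjointRel (pairRel D κ) := by
  intro x y
  constructor
  · rintro ⟨h1, h2⟩ p q ⟨h3, h4⟩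
    have e1 := (hD _ _).1 h1 _ _ h3
    have e2 := (hD _ _).1 h2 _ _ h4
    simp only [inner_sub_right, inner_sub_left, inner_smul_left, inner_smul_right, hκ] at e1 e2
    change inner ℂ p.fst y.fst + inner ℂ p.snd y.snd =
      -(inner ℂ q.fst x.fst + inner ℂ q.snd x.snd)
    linear_combination e1 + e2
  · intro h
    constructor
    · rw [hD]
      intro p q hpq
      have := h (WithLp.toLp 2 (p, 0)) (WithLp.toLp 2 (q + κ • p, 0))
        ⟨by simpa using hpq, by simpa using hD.zero⟩
      simp [WithLp.prod_inner_apply, inner_add_left, inner_smul_left, hκ] at this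
      rw [inner_sub_right, inner_smul_right]
      linear_combination this
    · rw [hD]
      intro p q hpq
      have := h (WithLp.toLp 2 (0, p)) (WithLp.toLp 2 (0, q + κ • p))
        ⟨by simpa using hD.zero, by simpa using hpq⟩
      simp [WithLp.prod_inner_apply, inner_add_left, inner_smul_left, hκ] at this
      rw [inner_sub_right, inner_smul_right]
      linear_combination this

/-- The first order system `(D + κ) u - m p`, `(D + κ) p + z r u` is bounded below by `√c`. -/
def SystemBound (D : H → H → Prop) (m r : H →L[ℂ] H) (z κ : ℂ) (c : ℝ) : Prop :=
  ∀ u w p q, D u w → D p q →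
    c * (‖u‖ ^ 2 + ‖p‖ ^ 2) ≤ ‖w + κ • u - m p‖ ^ 2 + ‖q + κ • p + z • r u‖ ^ 2

/-- The zeroth order part of the first order system. -/
def pairPot (m r : H →L[ℂ] H) (z : ℂ) : WithLp 2 (H × H) →L[ℂ] WithLp 2 (H × H) :=
  (WithLp.prodContinuousLinearEquiv 2 ℂ H H).symm.toContinuousLinearMap ∘L
    ((-(m ∘L ContinuousLinearMap.snd ℂ H H)).prod (z • (r ∘L ContinuousLinearMap.fst ℂ H H))) ∘L
      (WithLp.prodContinuousLinearEquiv 2 ℂ H H).toContinuousLinearMap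

@[simp] lemma pairPot_fst (m r : H →L[ℂ] H) (z : ℂ) (x : WithLp 2 (H × H)) :
    (pairPot m r z x).fst = -m x.snd := rfl

@[simp] lemma pairPot_snd (m r : H →L[ℂ] H) (z : ℂ) (x : WithLp 2 (H × H)) :
    (pairPot m r z x).snd = z • r x.fst := rfl

lemma systemBound_iff {D : H → H → Prop} {m r : H →L[ℂ] H} {z κ : ℂ} {c : ℝ} (hc : 0 ≤ c) :
    SystemBound D m r z κ (c ^ 2) ↔
      ∀ x y, pairRel D κ x y → c * ‖x‖ ≤ ‖y + pairPot m r z x‖ := by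
  constructor
  · rintro h x y ⟨h1, h2⟩
    have h3 := h _ _ _ _ h1 h2
    rw [← sq_le_sq₀ (by positivity) (by positivity), mul_pow, WithLp.prod_norm_sq_eq_of_L2,
      WithLp.prod_norm_sq_eq_of_L2]
    simpa [sub_eq_add_neg] using h3
  · intro h u w p q h1 h2
    have h3 := h (WithLp.toLp 2 (u, p)) (WithLp.toLp 2 (w + κ • u, q + κ • p))
      ⟨by simpa using h1, by simpa using h2⟩
    rw [← sq_le_sq₀ (by positivity) (by positivity), mul_pow, WithLp.prod_norm_sq_eq_of_L2,
      WithLp.prod_norm_sq_eq_of_L2] at h3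
    simpa [sub_eq_add_neg] using h3

variable [CompleteSpace H]

/-- Since m and r are symmetric, taking the adjoint exchanges the off-diagonal entries and
conjugates z. This is why the adjoint system is again a system of the same form. -/
lemma pairPot_adjoint {m r : H →L[ℂ] H} (hm : ∀ x y, inner ℂ (m x) y = inner ℂ x (m y))
    (hr : ∀ x y, inner ℂ (r x) y = inner ℂ x (r y)) (z : ℂ) (x : WithLp 2 (H × H)) :
    ((pairPot m r z).adjoint x).fst = starRingEnd ℂ z • r x.snd ∧
      ((pairPot m r z).adjoint x).snd = -m x.fst := by
  have : (pairPot m r z).adjoint x =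
      WithLp.toLp 2 (starRingEnd ℂ z • r x.snd, -m x.fst) := by
    refine ext_inner_left ℂ fun y => ?_
    rw [ContinuousLinearMap.adjoint_inner_right, WithLp.prod_inner_apply,
      WithLp.prod_inner_apply]
    change inner ℂ (-m y.snd) x.fst + inner ℂ (z • r y.fst) x.snd =
      inner ℂ y.fst (starRingEnd ℂ z • r x.snd) + inner ℂ y.snd (-m x.fst)
    simp only [inner_neg_left, inner_neg_right, inner_smul_left, inner_smul_right, hm, hr]
    ring
  rw [this]
  exact ⟨rfl, rfl⟩

/-- The system is boundedly invertible if it and the system for the conjugate spectral parameter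
are bounded below. -/
lemma exists_system_inverse {D : H → H → Prop} (hD : IsSkewAdjointRel D) {m r : H →L[ℂ] H}
    (hm : ∀ x y, inner ℂ (m x) y = inner ℂ x (m y))
    (hr : ∀ x y, inner ℂ (r x) y = inner ℂ x (r y)) {z κ : ℂ} (hκ : starRingEnd ℂ κ = -κ)
    {c c' : ℝ} (hc : 0 < c) (hc' : 0 < c') (h : SystemBound D m r z κ c)
    (h' : SystemBound D m r (starRingEnd ℂ z) κ c') :
    ∃ S : WithLp 2 (H × H) →L[ℂ] WithLp 2 (H × H),
      ∀ f, pairRel D κ (S f) (f - pairPot m r z (S f)) := by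
  have hs := Real.sq_sqrt hc.le
  have hB := (systemBound_iff (Real.sqrt_nonneg c)).1 (hs.symm ▸ h)
  refine (hD.pairRel hκ).exists_inverse _ (Real.sqrt_pos.2 hc) hB
    ((hD.pairRel hκ).surjective_add _ (Real.sqrt_pos.2 hc) hB ?_)
  rintro x ⟨h1, h2⟩
  rw [(pairPot_adjoint hm hr z x).1] at h1
  rw [(pairPot_adjoint hm hr z x).2] at h2
  -- If x is in the kernel of the adjoint, then (u, p) = (x.snd, -x.fst) solves the homogeneous
  -- system for the conjugate of z.
  have h3 := h' _ _ _ _ h2 (hD.neg h1)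
  have e1 : -m x.fst - κ • x.snd + κ • x.snd - m (-x.fst) = 0 := by rw [map_neg]; abel
  have e2 : -(starRingEnd ℂ z • r x.snd - κ • x.fst) + κ • -x.fst +
      starRingEnd ℂ z • r x.snd = 0 := by rw [smul_neg]; abel
  rw [e1, e2] at h3
  simp only [norm_zero, norm_neg] at h3
  have h4 : ‖x.fst‖ ^ 2 + ‖x.snd‖ ^ 2 ≤ 0 := by
    by_contra h
    push Not at h
    nlinarith
  rw [← norm_eq_zero, ← sq_eq_zero_iff, WithLp.prod_norm_sq_eq_of_L2]
  exact le_antisymm h4 (by positivity)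

/-- If the system is onto and bounded below, then so is the one for the conjugate spectral
parameter. -/
lemma SystemBound.conj {D : H → H → Prop} (hD : IsSkewAdjointRel D) {m r : H →L[ℂ] H}
    (hm : ∀ x y, inner ℂ (m x) y = inner ℂ x (m y))
    (hr : ∀ x y, inner ℂ (r x) y = inner ℂ x (r y)) {z κ : ℂ} (hκ : starRingEnd ℂ κ = -κ)
    {c : ℝ} (hc : 0 < c) (h : SystemBound D m r z κ c)
    (hs : ∀ f g, ∃ u w p q, D u w ∧ D p q ∧ w + κ • u - m p = f ∧ q + κ • p + z • r u = g) :
    SystemBound D m r (starRingEnd ℂ z) κ c := by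
  have hq := Real.sq_sqrt hc.le
  have hB := (systemBound_iff (Real.sqrt_nonneg c)).1 (hq.symm ▸ h)
  intro u w p q h1 h2
  -- The adjoint system evaluated at (-p, u) is the system for the conjugate of z at (u, p), up to
  -- the order of the components and a sign.
  have h3 := (hD.pairRel hκ).adjoint_bound _ (Real.sqrt_pos.2 hc) hB (fun f => by
    obtain ⟨u, w, p, q, h1, h2, h3, h4⟩ := hs f.fst f.snd
    refine ⟨WithLp.toLp 2 (u, p), WithLp.toLp 2 (w + κ • u, q + κ • p),
      ⟨by simpa using h1, by simpa using h2⟩, ?_⟩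
    have : f = WithLp.toLp 2 (f.fst, f.snd) := rfl
    rw [this, ← h3, ← h4, sub_eq_add_neg]
    rfl) (x := WithLp.toLp 2 (-p, u)) (y := WithLp.toLp 2 (-q - κ • p, w + κ • u))
    ⟨by simpa using hD.neg h2, by simpa using h1⟩
  rw [← sq_le_sq₀ (by positivity) (by positivity), mul_pow, hq, WithLp.prod_norm_sq_eq_of_L2,
    WithLp.prod_norm_sq_eq_of_L2, WithLp.sub_fst, WithLp.sub_snd, (pairPot_adjoint hm hr z _).1,
    (pairPot_adjoint hm hr z _).2] at h3
  have e1 : -q - κ • p - starRingEnd ℂ z • r u = -(q + κ • p + starRingEnd ℂ z • r u) := by abel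
  have e2 : w + κ • u - -m (-p) = w + κ • u - m p := by rw [map_neg, neg_neg]
  change c * (‖-p‖ ^ 2 + ‖u‖ ^ 2) ≤ ‖-q - κ • p - starRingEnd ℂ z • r u‖ ^ 2 +
    ‖w + κ • u - -m (-p)‖ ^ 2 at h3
  rw [e1, e2, norm_neg, norm_neg] at h3
  linarith

end System

/-! ### Resolvent set and lower bounds -/

section Resolvent

variable {H : Type*} [NormedAddCommGroup H] [InnerProductSpace ℂ H]

/-- In terms of the graph the domain subtype disappears, and `graph_op` can be used. -/
lemma mem_resolventSetOp_iff_graph {A : H →ₗ.[ℂ] H} {z : ℂ} :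
    z ∈ resolventSetOp A ↔ ∃ R : H →L[ℂ] H, (∀ f, (R f, f + z • R f) ∈ A.graph) ∧
      ∀ u F, (u, F) ∈ A.graph → R (F - z • u) = u := by
  constructor
  · rintro ⟨R, h1, h2⟩
    refine ⟨R, fun f => ?_, fun u F hF => ?_⟩
    · obtain ⟨h, hf⟩ := h1 f
      rw [LinearPMap.mem_graph_iff]
      exact ⟨⟨R f, h⟩, rfl, sub_eq_iff_eq_add.1 hf⟩
    · obtain ⟨y, rfl, hy⟩ := (LinearPMap.mem_graph_iff _).1 hF
      have hy' : A y = F := hy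
      rw [← hy']
      exact h2 y
  · rintro ⟨R, h1, h2⟩
    refine ⟨R, fun f => ?_, fun u => h2 _ _ (A.mem_graph u)⟩
    obtain ⟨y, hy, hy'⟩ := (LinearPMap.mem_graph_iff _).1 (h1 f)
    have hy1 : (y : H) = R f := hy
    have h : R f ∈ A.domain := hy1 ▸ y.2
    have e : (⟨R f, h⟩ : A.domain) = y := Subtype.ext hy1.symm
    exact ⟨h, by rw [e, hy', add_sub_cancel_right]⟩

/-- For the spectral parameter `-1` the system is always bounded below. -/
lemma systemBound_neg_one {D : H → H → Prop} (hD : IsSkewAdjointRel D) {m r : H →L[ℂ] H} {κ : ℂ}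
    (hκ : starRingEnd ℂ κ = -κ) {c : ℝ} (hc : 0 < c)
    (hm : ∀ x, c * ‖x‖ ^ 2 ≤ (inner ℂ x (m x)).re)
    (hr : ∀ x, c * ‖x‖ ^ 2 ≤ (inner ℂ x (r x)).re) : SystemBound D m r (-1) κ (c ^ 2) := by
  intro u w p q h1 h2
  set f := w + κ • u - m p with hf
  set g := q + κ • p + (-1 : ℂ) • r u with hg
  have hκre : κ.re = 0 := by
    have := congrArg Complex.re hκ
    simp only [Complex.conj_re, Complex.neg_re] at this
    linarith
  have e0 := (hD _ _).1 h1 p q h2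
  -- Pair the first equation with p and the second with u. For z = -1 the two potential terms have
  -- the same sign, and the D and κ terms combine to a purely imaginary number.
  have e1 : inner ℂ p f + inner ℂ u g + inner ℂ p (m p) + inner ℂ u (r u) =
      (inner ℂ u q - inner ℂ q u) + κ * (inner ℂ p u + inner ℂ u p) := by
    rw [hf, hg]
    simp only [inner_add_right, inner_sub_right, inner_smul_right, e0]
    ring
  have e2 : (inner ℂ u q - inner ℂ q u + κ * (inner ℂ p u + inner ℂ u p)).re = 0 := by
    rw [← inner_conj_symm u q, ← inner_conj_symm u p]
    simp only [Complex.add_re, Complex.sub_re, Complex.mul_re, Complex.add_im, Complex.conj_re,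
      Complex.conj_im, hκre]
    ring
  rw [← e1] at e2
  simp only [Complex.add_re] at e2
  have b1 : -(inner ℂ p f).re ≤ ‖p‖ * ‖f‖ :=
    (neg_le_abs _).trans ((Complex.abs_re_le_norm _).trans (norm_inner_le_norm _ _))
  have b2 : -(inner ℂ u g).re ≤ ‖u‖ * ‖g‖ :=
    (neg_le_abs _).trans ((Complex.abs_re_le_norm _).trans (norm_inner_le_norm _ _))
  have b3 := hm p
  have b4 := hr u
  have b5 : c * (‖p‖ ^ 2 + ‖u‖ ^ 2) ≤ ‖p‖ * ‖f‖ + ‖u‖ * ‖g‖ := by linarith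
  -- Multiply `b5` by c and use c ‖p‖ ‖f‖ ≤ (c² ‖p‖² + ‖f‖²) / 2, likewise for u and g; half of the
  -- left side is absorbed, leaving the constant c².
  nlinarith [sq_nonneg (c * ‖p‖ - ‖f‖), sq_nonneg (c * ‖u‖ - ‖g‖)]

variable [CompleteSpace H]

/-- The resolvent set of `-r⁻¹ (D + κ) m⁻¹ (D + κ)` is described by lower bounds for the first order
system. -/
lemma mem_resolventSetOp_iff_systemBound {D : H → H → Prop} (hD : IsSkewAdjointRel D)
    {m r : H →L[ℂ] H} (hm : ∀ x y, inner ℂ (m x) y = inner ℂ x (m y))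
    (hr : ∀ x y, inner ℂ (r x) y = inner ℂ x (r y)) {κ : ℂ} (hκ : starRingEnd ℂ κ = -κ)
    {c : ℝ} (hc : 0 < c) (hm0 : ∀ x, c * ‖x‖ ^ 2 ≤ (inner ℂ x (m x)).re)
    (hr0 : ∀ x, c * ‖x‖ ^ 2 ≤ (inner ℂ x (r x)).re) {A : H →ₗ.[ℂ] H}
    (hA : ∀ u F, (u, F) ∈ A.graph ↔
      ∃ w p q, D u w ∧ m p = w + κ • u ∧ D p q ∧ r F = -(q + κ • p)) (z : ℂ) :
    z ∈ resolventSetOp A ↔ (∃ a > 0, SystemBound D m r z κ a) ∧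
      ∃ a > 0, SystemBound D m r (starRingEnd ℂ z) κ a := by
  rw [mem_resolventSetOp_iff_graph]
  constructor
  · rintro ⟨R, hR1, hR2⟩
    have hB := systemBound_neg_one hD hκ hc hm0 hr0
    have hB' : SystemBound D m r (starRingEnd ℂ (-1)) κ (c ^ 2) := by simpa using hB
    obtain ⟨S, hS⟩ := exists_system_inverse hD hm hr hκ (by positivity) (by positivity) hB hB'
    have hsol : ∀ f g : H, ∃ u w p q, D u w ∧ D p q ∧ w + κ • u - m p = f ∧
        q + κ • p + (-1 : ℂ) • r u = g := by
      intro f g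
      obtain ⟨h1, h2⟩ := hS (WithLp.toLp 2 (f, g))
      set s := S (WithLp.toLp 2 (f, g))
      refine ⟨_, _, _, _, h1, h2, ?_, ?_⟩
      · change f - -m s.snd - κ • s.fst + κ • s.fst - m s.snd = f
        abel
      · change g - (-1 : ℂ) • r s.fst - κ • s.snd + κ • s.snd + (-1 : ℂ) • r s.fst = g
        abel
    have hlow : ∃ a > 0, SystemBound D m r z κ a := by
      -- K bounds ‖u‖ by ‖u₀‖, where (u₀, p₀) solves the system for -1 with the data f, g of (u, p).
      -- M collects the cost of replacing z by -1 in the second equation, with ‖u₀‖² bounded by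
      -- (‖f‖² + ‖g‖²) / c².
      set K := ‖R‖ * ‖z + 1‖ + 1 with hK
      have hK0 : 0 < K := by positivity
      set M := 2 + 2 * (‖z + 1‖ * ‖r‖ * K) ^ 2 / c ^ 2 with hM
      have hM0 : 0 < M := by positivity
      refine ⟨c ^ 2 / M, by positivity, fun u w p q h1 h2 => ?_⟩
      set f := w + κ • u - m p with hf
      set g := q + κ • p + z • r u with hg
      obtain ⟨u0, w0, p0, q0, h3, h4, h5, h6⟩ := hsol f g
      have b0 := hB _ _ _ _ h3 h4
      rw [h5, h6] at b0
      -- The difference of the two solutions satisfies the first equation with right-hand side 0, so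
      -- u - u₀ is in the domain of A, and (A - z)(u - u₀) = (z + 1) u₀.
      have hu : u - u0 = R ((z + 1) • u0) := by
        have hg1 : (u - u0, z • (u - u0) + (z + 1) • u0) ∈ A.graph := by
          rw [hA]
          refine ⟨w - w0, p - p0, q - q0, hD.sub h1 h3, ?_, hD.sub h2 h4, ?_⟩
          · have : m p - m p0 = w + κ • u - (w0 + κ • u0) := by
              have e : w0 + κ • u0 - m p0 = w + κ • u - m p := h5
              rw [sub_eq_sub_iff_add_eq_add] at e ⊢
              rw [add_comm, ← e]
            rw [map_sub, this, smul_sub]; abel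
          · have e : q0 + κ • p0 + (-1 : ℂ) • r u0 = q + κ • p + z • r u := h6
            have e' : q + κ • p = q0 + κ • p0 + (-1 : ℂ) • r u0 - z • r u :=
              eq_sub_of_add_eq e.symm
            have : q - q0 + κ • (p - p0) = q + κ • p - (q0 + κ • p0) := by
              rw [smul_sub]; abel
            rw [this, e']
            simp only [map_add, map_smul, map_sub]
            module
        have := hR2 _ _ hg1
        rw [add_sub_cancel_left] at this
        exact this.symm
      have hun : ‖u‖ ≤ K * ‖u0‖ := by
        calc ‖u‖ = ‖R ((z + 1) • u0) + u0‖ := by rw [← hu, sub_add_cancel]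
          _ ≤ ‖R‖ * ‖(z + 1) • u0‖ + ‖u0‖ :=
            (norm_add_le _ _).trans (by gcongr; exact R.le_opNorm _)
          _ = K * ‖u0‖ := by rw [norm_smul, hK]; ring
      have b1 := hB _ _ _ _ h1 h2
      have e1 : q + κ • p + (-1 : ℂ) • r u = g - (z + 1) • r u := by rw [hg]; module
      rw [e1, ← hf] at b1
      have b2 : ‖g - (z + 1) • r u‖ ^ 2 ≤ 2 * ‖g‖ ^ 2 + 2 * (‖z + 1‖ * ‖r‖ * K) ^ 2 * ‖u0‖ ^ 2 := by
        have h7 : ‖(z + 1) • r u‖ ≤ ‖z + 1‖ * ‖r‖ * K * ‖u0‖ := by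
          rw [norm_smul, mul_assoc, mul_assoc]
          gcongr
          exact (r.le_opNorm _).trans (by gcongr)
        have h8 := norm_sub_le g ((z + 1) • r u)
        calc ‖g - (z + 1) • r u‖ ^ 2 ≤ (‖g‖ + ‖z + 1‖ * ‖r‖ * K * ‖u0‖) ^ 2 := by gcongr; linarith
          _ ≤ _ := by nlinarith [sq_nonneg (‖g‖ - ‖z + 1‖ * ‖r‖ * K * ‖u0‖)]
      have b3 : ‖u0‖ ^ 2 ≤ (‖f‖ ^ 2 + ‖g‖ ^ 2) / c ^ 2 := by
        rw [le_div_iff₀ (by positivity)]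
        nlinarith [sq_nonneg ‖p0‖, sq_nonneg c, mul_nonneg (sq_nonneg c) (sq_nonneg ‖p0‖)]
      rw [div_mul_eq_mul_div, div_le_iff₀ hM0]
      calc c ^ 2 * (‖u‖ ^ 2 + ‖p‖ ^ 2) ≤
          ‖f‖ ^ 2 + (2 * ‖g‖ ^ 2 + 2 * (‖z + 1‖ * ‖r‖ * K) ^ 2 * ((‖f‖ ^ 2 + ‖g‖ ^ 2) / c ^ 2)) :=
            b1.trans (by gcongr; exact b2.trans (by gcongr))
        _ ≤ (‖f‖ ^ 2 + ‖g‖ ^ 2) * M := by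
            rw [hM]
            have : (‖f‖ ^ 2 + ‖g‖ ^ 2) * (2 + 2 * (‖z + 1‖ * ‖r‖ * K) ^ 2 / c ^ 2) =
              2 * ‖f‖ ^ 2 + 2 * ‖g‖ ^ 2 +
                2 * (‖z + 1‖ * ‖r‖ * K) ^ 2 * ((‖f‖ ^ 2 + ‖g‖ ^ 2) / c ^ 2) := by ring
            rw [this]
            nlinarith [sq_nonneg ‖f‖]
    refine ⟨hlow, ?_⟩
    obtain ⟨a, ha, hlow⟩ := hlow
    refine ⟨a, ha, hlow.conj hD hm hr hκ ha fun f g => ?_⟩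
    obtain ⟨u0, w0, p0, q0, h3, h4, h5, h6⟩ := hsol f g
    -- The solution for -1 misses the second equation for z by (z + 1) r u₀; adding the resolvent
    -- applied to (z + 1) u₀ corrects this without disturbing the first equation.
    obtain ⟨w, p, q, h7, h8, h9, h10⟩ := (hA _ _).1 (hR1 ((z + 1) • u0))
    refine ⟨_, _, _, _, hD.add h3 h7, hD.add h4 h9, ?_, ?_⟩
    · rw [map_add, h8, ← h5]
      module
    · simp only [map_add, map_smul] at h10 ⊢
      have : q + κ • p = -((z + 1) • r u0 + z • r (R ((z + 1) • u0))) := by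
        rw [map_smul, map_smul, h10, neg_neg]
      have e : q0 + q + κ • (p0 + p) = q0 + κ • p0 + (q + κ • p) := by module
      rw [e, this, ← h6, map_smul, map_smul]
      module
  · rintro ⟨⟨a, ha, h⟩, ⟨a', ha', h'⟩⟩
    obtain ⟨S, hS⟩ := exists_system_inverse hD hm hr hκ ha ha' h h'
    -- The resolvent is the first component of the solution of the system with data (0, -r f).
    let J : H →L[ℂ] WithLp 2 (H × H) :=
      (WithLp.prodContinuousLinearEquiv 2 ℂ H H).symm.toContinuousLinearMap ∘L
        ((0 : H →L[ℂ] H).prod (-r))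
    let R : H →L[ℂ] H := ContinuousLinearMap.fst ℂ H H ∘L
      (WithLp.prodContinuousLinearEquiv 2 ℂ H H).toContinuousLinearMap ∘L S ∘L J
    have hR : ∀ f, R f = (S (J f)).fst := fun f => rfl
    have hsol : ∀ f, ∃ w p q, D (R f) w ∧ D p q ∧ w + κ • R f - m p = 0 ∧
        q + κ • p + z • r (R f) = -r f := by
      intro f
      obtain ⟨h1, h2⟩ := hS (J f)
      refine ⟨_, _, _, h1, h2, ?_, ?_⟩
      · change 0 - -m (S (J f)).snd - κ • (S (J f)).fst + κ • (S (J f)).fst - m (S (J f)).snd = 0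
        abel
      · change -r f - z • r (S (J f)).fst - κ • (S (J f)).snd + κ • (S (J f)).snd +
          z • r (S (J f)).fst = -r f
        abel
    refine ⟨R, fun f => ?_, fun u F hF => ?_⟩
    · obtain ⟨w, p, q, h1, h2, h3, h4⟩ := hsol f
      refine (hA _ _).2 ⟨w, p, q, h1, (sub_eq_zero.1 h3).symm, h2, ?_⟩
      rw [eq_sub_of_add_eq h4, map_add, map_smul]
      abel
    · obtain ⟨w, p, q, h1, h2, h3, h4⟩ := hsol (F - z • u)
      obtain ⟨w', p', q', h1', h2', h3', h4'⟩ := (hA _ _).1 hF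
      have h5 := h _ _ _ _ (hD.sub h1 h1') (hD.sub h2 h3')
      have e1 : w - w' + κ • (R (F - z • u) - u) - m (p - p') = 0 := by
        rw [map_sub m, h2', ← sub_eq_zero.1 h3]
        module
      have e2 : q - q' + κ • (p - p') + z • r (R (F - z • u) - u) = 0 := by
        have e3 : q + κ • p = -r (F - z • u) - z • r (R (F - z • u)) := eq_sub_of_add_eq h4
        have e4 : q' + κ • p' = -r F := by rw [h4', neg_neg]
        have : q - q' + κ • (p - p') = q + κ • p - (q' + κ • p') := by module
        rw [this, e3, e4]
        simp only [map_sub, map_smul]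
        module
      rw [e1, e2, norm_zero] at h5
      have h6 : ‖R (F - z • u) - u‖ ^ 2 ≤ 0 := by
        by_contra hn
        push Not at hn
        nlinarith [mul_pos ha hn, mul_nonneg ha.le (sq_nonneg ‖p - p'‖)]
      have h7 : ‖R (F - z • u) - u‖ = 0 := sq_eq_zero_iff.1 (le_antisymm h6 (sq_nonneg _))
      exact sub_eq_zero.1 (norm_eq_zero.1 h7)

end Resolvent

/-! ### Lattice of periods and periodization -/

/-- The group of periods. -/
def lat (p : Periodicity) : AddSubgroup (ℝ × ℝ) where
  carrier := {g | ∃ n m : ℤ, (p = .first → m = 0) ∧ g = ((n : ℝ), (m : ℝ))}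
  add_mem' := by
    rintro _ _ ⟨n, m, h, rfl⟩ ⟨n', m', h', rfl⟩
    exact ⟨n + n', m + m', fun hp => by simp [h hp, h' hp], by simp⟩
  zero_mem' := ⟨0, 0, fun _ => rfl, by ext <;> simp⟩
  neg_mem' := by
    rintro _ ⟨n, m, h, rfl⟩
    exact ⟨-n, -m, fun hp => by simp [h hp], by simp⟩

instance (p : Periodicity) : Countable (lat p) := by
  have : (lat p : Set (ℝ × ℝ)) ⊆ range fun n : ℤ × ℤ => ((n.1 : ℝ), (n.2 : ℝ)) := by
    rintro _ ⟨n, m, -, rfl⟩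
    exact ⟨(n, m), rfl⟩
  exact ((countable_range _).mono this).to_subtype

lemma sub_fold_mem_lat (p : Periodicity) (y : ℝ × ℝ) : y - fold p y ∈ lat p := by
  refine ⟨(shift p y).1, (shift p y).2, ?_, by simp [fold]⟩
  rintro rfl
  rfl

lemma fold_add_lat {p : Periodicity} {g : ℝ × ℝ} (hg : g ∈ lat p) (y : ℝ × ℝ) :
    fold p (g + y) = fold p y := by
  obtain ⟨n, m, h, rfl⟩ := hg
  cases p
  · obtain rfl := h rfl
    ext <;> simp [fold, shift]
  · ext <;> simp [fold, shift]

lemma perExt_add_lat {p : Periodicity} {g : ℝ × ℝ} (hg : g ∈ lat p) (U : L2per p) (y : ℝ × ℝ) :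
    perExt p U (g + y) = perExt p U y := by
  simp only [perExt, fold_add_lat hg]

lemma perExt_eq_on_cell {p : Periodicity} (U : L2per p) {y : ℝ × ℝ} (hy : y ∈ cell p) :
    perExt p U y = U y := by
  simp only [perExt, fold_eq_self p hy]

lemma isAddFundamentalDomain_cell (p : Periodicity) :
    IsAddFundamentalDomain (lat p) (cell p) (volume : Measure (ℝ × ℝ)) := by
  refine IsAddFundamentalDomain.mk' (measurableSet_cell p).nullMeasurableSet fun y => ?_
  refine ⟨⟨fold p y - y, by simpa using (lat p).neg_mem (sub_fold_mem_lat p y)⟩, ?_, ?_⟩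
  · change fold p y - y + y ∈ cell p
    rw [sub_add_cancel]
    exact fold_mem_cell p y
  · rintro ⟨g, hg⟩ h
    change g + y ∈ cell p at h
    refine Subtype.ext (eq_sub_of_add_eq ?_)
    change g + y = fold p y
    rw [← fold_add_lat hg, fold_eq_self p h]

lemma finite_lat_norm_le (p : Periodicity) (r : ℝ) : {g : lat p | ‖(g : ℝ × ℝ)‖ ≤ r}.Finite := by
  obtain ⟨N, hN⟩ := exists_nat_ge r
  refine Set.Finite.of_finite_image (f := Subtype.val) ?_ Subtype.val_injective.injOn
  refine Set.Finite.subset (((finite_Icc (-(N : ℤ)) N).prod (finite_Icc (-(N : ℤ)) N)).image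
    fun n : ℤ × ℤ => ((n.1 : ℝ), (n.2 : ℝ))) ?_
  rintro _ ⟨⟨_, n, m, _, rfl⟩, hg, rfl⟩
  change ‖((n : ℝ), (m : ℝ))‖ ≤ r at hg
  have hi : ∀ k : ℤ, |(k : ℝ)| ≤ r → k ∈ Icc (-(N : ℤ)) N := fun k hk => by
    have := abs_le.1 (hk.trans hN)
    exact ⟨by exact_mod_cast this.1, by exact_mod_cast this.2⟩
  exact ⟨(n, m), ⟨hi n ((norm_fst_le _).trans hg), hi m ((norm_snd_le _).trans hg)⟩, rfl⟩

/-- A nonzero component of a period occurs only in a direction in which the cell is [0,1), so moving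
within the cell costs at most 1. Hence only finitely many translates of a compact set meet the cell,
even when the cell is unbounded. -/
lemma norm_lat_le_of_mem_cell {p : Periodicity} {g y : ℝ × ℝ} {r : ℝ} (hg : g ∈ lat p)
    (hy : y ∈ cell p) (h : ‖g + y‖ ≤ r) : ‖g‖ ≤ r + 1 := by
  have hr : 0 ≤ r := (norm_nonneg _).trans h
  have h1 : |g.1 + y.1| ≤ r := (norm_fst_le (g + y)).trans h
  have h2 : |g.2 + y.2| ≤ r := (norm_snd_le (g + y)).trans h
  rw [abs_le] at h1 h2
  obtain ⟨n, m, hm, rfl⟩ := hg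
  rw [Prod.norm_def, sup_le_iff, Real.norm_eq_abs, Real.norm_eq_abs, abs_le, abs_le]
  cases p
  · obtain ⟨⟨a, b⟩, -⟩ := hy
    obtain rfl := hm rfl
    simp only [Int.cast_zero] at *
    refine ⟨⟨?_, ?_⟩, ?_, ?_⟩ <;> linarith
  · obtain ⟨⟨a, b⟩, c, d⟩ := hy
    simp only at *
    refine ⟨⟨?_, ?_⟩, ?_, ?_⟩ <;> linarith

/-- The periodization of a function on the plane. -/
def perSum (p : Periodicity) (φ : ℝ × ℝ → ℂ) (y : ℝ × ℝ) : ℂ := ∑' g : lat p, φ (g + y)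

lemma perSum_add_lat {p : Periodicity} {g : ℝ × ℝ} (hg : g ∈ lat p) (φ : ℝ × ℝ → ℂ) (y : ℝ × ℝ) :
    perSum p φ (g + y) = perSum p φ y := by
  refine Eq.trans ?_ ((Equiv.addRight (⟨g, hg⟩ : lat p)).tsum_eq fun k : lat p => φ (k + y))
  refine tsum_congr fun k => ?_
  simp [add_assoc]

lemma perSum_fold (p : Periodicity) (φ : ℝ × ℝ → ℂ) (y : ℝ × ℝ) :
    perSum p φ (fold p y) = perSum p φ y := by
  have := perSum_add_lat (sub_fold_mem_lat p y) φ (fold p y)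
  rw [sub_add_cancel] at this
  exact this.symm

lemma exists_norm_le_of_hasCompactSupport {φ : ℝ × ℝ → ℂ} (hs : HasCompactSupport φ) :
    ∃ r, ∀ y, φ y ≠ 0 → ‖y‖ ≤ r := by
  obtain ⟨r, hr⟩ := hs.isCompact.isBounded.subset_closedBall (0 : ℝ × ℝ)
  exact ⟨r, fun y hy => by simpa using hr (subset_tsupport φ hy)⟩

lemma exists_finset_cell (p : Periodicity) {φ : ℝ × ℝ → ℂ} (hs : HasCompactSupport φ) :
    ∃ S : Finset (lat p), ∀ g ∉ S, ∀ y ∈ cell p, φ (g + y) = 0 := by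
  obtain ⟨r, hr⟩ := exists_norm_le_of_hasCompactSupport hs
  refine ⟨(finite_lat_norm_le p (r + 1)).toFinset, fun g hg y hy => ?_⟩
  by_contra h
  exact hg (by simpa using norm_lat_le_of_mem_cell g.2 hy (hr _ h))

lemma exists_finset_ball (p : Periodicity) (r : ℝ) {φ : ℝ × ℝ → ℂ} (hs : HasCompactSupport φ) :
    ∃ S : Finset (lat p), ∀ g ∉ S, ∀ y : ℝ × ℝ, ‖y‖ ≤ r → (g : ℝ × ℝ) + y ∉ tsupport φ := by
  obtain ⟨r', hr⟩ := hs.isCompact.isBounded.subset_closedBall (0 : ℝ × ℝ)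
  refine ⟨(finite_lat_norm_le p (r' + r)).toFinset, fun g hg y hy h => hg ?_⟩
  have h1 : ‖(g : ℝ × ℝ)‖ ≤ ‖(g : ℝ × ℝ) + y‖ + ‖y‖ := norm_le_add_norm_add _ _
  have h2 : ‖(g : ℝ × ℝ) + y‖ ≤ r' := by simpa using hr h
  simpa using h1.trans (add_le_add h2 hy)

lemma perSum_eq_sum {p : Periodicity} {φ : ℝ × ℝ → ℂ} {S : Finset (lat p)} {y : ℝ × ℝ}
    (h : ∀ g ∉ S, φ (g + y) = 0) : perSum p φ y = ∑ g ∈ S, φ (g + y) :=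
  tsum_eq_sum h

lemma memLp_translate {φ : ℝ × ℝ → ℂ} (hφ : Continuous φ) (hs : HasCompactSupport φ)
    (g : ℝ × ℝ) : MemLp (fun y => φ (g + y)) 2 volume :=
  (hφ.comp (continuous_const_add g)).memLp_of_hasCompactSupport
    (hs.comp_homeomorph (Homeomorph.addLeft g))

lemma memLp_perSum (p : Periodicity) {φ : ℝ × ℝ → ℂ} (hφ : Continuous φ)
    (hs : HasCompactSupport φ) : MemLp (perSum p φ) 2 (volume.restrict (cell p)) := by
  obtain ⟨S, hS⟩ := exists_finset_cell p hs
  have h : MemLp (fun y => ∑ g ∈ S, φ ((g : ℝ × ℝ) + y)) 2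
      ((volume : Measure (ℝ × ℝ)).restrict (cell p)) :=
    memLp_finsetSum S fun g _ => (memLp_translate hφ hs g).restrict _
  refine (memLp_congr_ae ?_).1 h
  filter_upwards [ae_restrict_mem (measurableSet_cell p)] with y hy
  exact (perSum_eq_sum fun g hg => hS g hg y hy).symm

open Classical in
/-- The element of `L2per p` given by the periodization of a test function. -/
def per (p : Periodicity) (φ : ℝ × ℝ → ℂ) : L2per p :=
  if h : MemLp (perSum p φ) 2 (volume.restrict (cell p)) then h.toLp else 0

lemma coeFn_per (p : Periodicity) {φ : ℝ × ℝ → ℂ} (hφ : Continuous φ)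
    (hs : HasCompactSupport φ) : per p φ =ᵐ[volume.restrict (cell p)] perSum p φ := by
  rw [per, dif_pos (memLp_perSum p hφ hs)]
  exact MemLp.coeFn_toLp _

lemma perExt_per (p : Periodicity) {φ : ℝ × ℝ → ℂ} (hφ : Continuous φ)
    (hs : HasCompactSupport φ) : perExt p (per p φ) =ᵐ[volume] perSum p φ := by
  filter_upwards [(quasiMeasurePreserving_fold p).ae (coeFn_per p hφ hs)] with y hy
  rw [perExt, hy, perSum_fold]

/-- Unfolding. -/
lemma inner_per (p : Periodicity) {φ : ℝ × ℝ → ℂ} (hφ : Continuous φ) (hs : HasCompactSupport φ)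
    (U : L2per p) : inner ℂ (per p φ) U = ∫ y, perExt p U y * starRingEnd ℂ (φ y) := by
  obtain ⟨S, hS⟩ := exists_finset_cell p hs
  have hint : Integrable (fun y => perExt p U y * starRingEnd ℂ (φ y)) volume :=
    integrable_perExt_mul p U (Complex.continuous_conj.comp hφ)
      (hs.comp_left (g := starRingEnd ℂ) (map_zero _))
  rw [(isAddFundamentalDomain_cell p).integral_eq_tsum'' _ hint]
  have e : ∀ g : lat p, ∫ y in cell p, perExt p U (g +ᵥ y) * starRingEnd ℂ (φ (g +ᵥ y)) =
      ∫ y in cell p, U y * starRingEnd ℂ (φ (g + y)) := fun g =>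
    setIntegral_congr_fun (measurableSet_cell p) fun y hy => by
      change perExt p U (g + y) * starRingEnd ℂ (φ (g + y)) = _
      rw [perExt_add_lat g.2, perExt_eq_on_cell U hy]
  simp_rw [e]
  rw [tsum_eq_sum (s := S), ← integral_finsetSum, L2.inner_def]
  · refine integral_congr_ae ?_
    filter_upwards [coeFn_per p hφ hs, ae_restrict_mem (measurableSet_cell p)] with y hy hc
    rw [RCLike.inner_apply, hy, perSum_eq_sum fun g hg => hS g hg y hc, map_sum, Finset.mul_sum]
  · intro g _
    exact (Lp.memLp U).integrable_mul (p := 2) (q := 2) ((memLp_translate hφ hs g).restrict _).star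
  · intro g hg
    rw [setIntegral_congr_fun (g := fun _ => (0 : ℂ)) (measurableSet_cell p) fun y hy => ?_]
    · simp
    · simp [hS g hg y hy]

/-! ### Test functions and the weak directional derivative -/

/-- Smooth compactly supported functions on the plane. -/
def IsTest (φ : ℝ × ℝ → ℂ) : Prop := ContDiff ℝ ∞ φ ∧ HasCompactSupport φ

/-- The derivative in the direction `θ`. -/
def dirD (θ : ℝ × ℝ) (φ : ℝ × ℝ → ℂ) (y : ℝ × ℝ) : ℂ := fderiv ℝ φ y θ

lemma IsTest.dirD {φ : ℝ × ℝ → ℂ} (h : IsTest φ) (θ : ℝ × ℝ) : IsTest (dirD θ φ) :=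
  ⟨(h.1.fderiv_right (m := ∞) (by simp)).clm_apply contDiff_const, h.2.fderiv_apply ℝ θ⟩

lemma IsTest.differentiable {φ : ℝ × ℝ → ℂ} (h : IsTest φ) : Differentiable ℝ φ :=
  h.1.differentiable (by simp)

lemma IsTest.add {φ ψ : ℝ × ℝ → ℂ} (h : IsTest φ) (h' : IsTest ψ) : IsTest fun y => φ y + ψ y :=
  ⟨h.1.add h'.1, h.2.add h'.2⟩

lemma IsTest.const_mul {φ : ℝ × ℝ → ℂ} (c : ℂ) (h : IsTest φ) : IsTest fun y => c * φ y :=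
  ⟨contDiff_const.mul h.1, h.2.mul_left⟩

lemma IsTest.zero : IsTest fun _ => 0 := ⟨contDiff_const, HasCompactSupport.zero⟩

lemma IsTest.conj {φ : ℝ × ℝ → ℂ} (h : IsTest φ) : IsTest fun y => starRingEnd ℂ (φ y) :=
  ⟨Complex.conjCLE.contDiff.comp h.1, h.2.comp_left (g := starRingEnd ℂ) (map_zero _)⟩

lemma IsTest.translate {φ : ℝ × ℝ → ℂ} (h : IsTest φ) (v : ℝ × ℝ) : IsTest fun y => φ (v + y) :=
  ⟨h.1.comp (contDiff_const.add contDiff_id), h.2.comp_homeomorph (Homeomorph.addLeft v)⟩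

lemma IsTest.reflect {φ : ℝ × ℝ → ℂ} (h : IsTest φ) (v : ℝ × ℝ) : IsTest fun y => φ (v - y) :=
  ⟨h.1.comp (contDiff_const.sub contDiff_id), h.2.comp_homeomorph (Homeomorph.subLeft v)⟩

lemma dirD_conj {φ : ℝ × ℝ → ℂ} (h : IsTest φ) (θ y : ℝ × ℝ) :
    dirD θ (fun y => starRingEnd ℂ (φ y)) y = starRingEnd ℂ (dirD θ φ y) := by
  have := Complex.conjCLE.hasFDerivAt.comp y (h.differentiable y).hasFDerivAt
  exact DFunLike.congr_fun this.fderiv θ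

lemma dirD_add {φ ψ : ℝ × ℝ → ℂ} (h : IsTest φ) (h' : IsTest ψ) (θ : ℝ × ℝ) :
    dirD θ (fun y => φ y + ψ y) = fun y => dirD θ φ y + dirD θ ψ y := by
  funext y
  exact DFunLike.congr_fun ((h.differentiable y).hasFDerivAt.add
    (h'.differentiable y).hasFDerivAt).fderiv θ

lemma dirD_const_mul {φ : ℝ × ℝ → ℂ} (c : ℂ) (h : IsTest φ) (θ : ℝ × ℝ) :
    dirD θ (fun y => c * φ y) = fun y => c * dirD θ φ y := by
  funext y
  exact DFunLike.congr_fun ((h.differentiable y).hasFDerivAt.const_mul c).fderiv θ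

lemma dirD_translate {φ : ℝ × ℝ → ℂ} (h : IsTest φ) (θ v y : ℝ × ℝ) :
    dirD θ (fun y => φ (v + y)) y = dirD θ φ (v + y) := by
  have := (h.differentiable (v + y)).hasFDerivAt.comp y ((hasFDerivAt_id y).const_add v)
  exact DFunLike.congr_fun this.fderiv θ

lemma dirD_reflect {φ : ℝ × ℝ → ℂ} (h : IsTest φ) (θ v y : ℝ × ℝ) :
    dirD θ (fun y => φ (v - y)) y = -dirD θ φ (v - y) := by
  have := (h.differentiable (v - y)).hasFDerivAt.comp y ((hasFDerivAt_id y).const_sub v)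
  refine (DFunLike.congr_fun this.fderiv θ).trans ?_
  simp [dirD]

lemma inner_per_test (p : Periodicity) {φ : ℝ × ℝ → ℂ} (h : IsTest φ) (U : L2per p) :
    inner ℂ (per p φ) U = ∫ y, perExt p U y * starRingEnd ℂ (φ y) :=
  inner_per p h.1.continuous h.2 U

/-- Unfolding turns integrals over the plane against a test function into inner products in L² of
the cell against its periodization, so Hilbert space arguments become available. The conjugate of a
test function is again a test function, which reconciles the bilinear and the sesquilinear pairings.
-/
lemma hasD_iff_inner (p : Periodicity) (θ : ℝ × ℝ) (U W : L2per p) :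
    HasD p θ U W ↔
      ∀ φ, IsTest φ → inner ℂ (per p (dirD θ φ)) U = -inner ℂ (per p φ) W := by
  constructor
  · intro h φ hφ
    have h1 := h _ hφ.conj.1 hφ.conj.2
    rw [inner_per_test p hφ, inner_per_test p (hφ.dirD θ), ← h1]
    refine integral_congr_ae (Eventually.of_forall fun y => ?_)
    simp only
    rw [← dirD_conj hφ]
    rfl
  · intro h φ h1 h2
    have hφ : IsTest φ := ⟨h1, h2⟩
    have h3 := h _ hφ.conj
    rw [inner_per_test p hφ.conj, inner_per_test p (hφ.conj.dirD θ)] at h3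
    simp only [dirD_conj hφ, Complex.conj_conj] at h3
    exact h3

lemma per_add (p : Periodicity) {φ ψ : ℝ × ℝ → ℂ} (h : IsTest φ) (h' : IsTest ψ) :
    per p (fun y => φ y + ψ y) = per p φ + per p ψ := by
  refine ext_inner_right ℂ fun U => ?_
  rw [inner_add_left, inner_per_test p h, inner_per_test p h', inner_per_test p (h.add h'),
    ← integral_add (integrable_perExt_mul p U h.conj.1.continuous h.conj.2)
      (integrable_perExt_mul p U h'.conj.1.continuous h'.conj.2)]
  simp only [map_add, mul_add]

lemma per_const_mul (p : Periodicity) {φ : ℝ × ℝ → ℂ} (c : ℂ) (h : IsTest φ) :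
    per p (fun y => c * φ y) = c • per p φ := by
  refine ext_inner_right ℂ fun U => ?_
  rw [inner_smul_left, inner_per_test p h, inner_per_test p (h.const_mul c),
    ← integral_const_mul]
  refine integral_congr_ae (Eventually.of_forall fun y => ?_)
  simp only [map_mul]
  ring

/-- Unfolding gives ‖per φ‖² as the integral over the plane of (periodization of φ) · conj φ, which
is translation invariant. -/
lemma norm_per_translate (p : Periodicity) {φ : ℝ × ℝ → ℂ} (h : IsTest φ) (v : ℝ × ℝ) :
    ‖per p (fun y => φ (v + y))‖ = ‖per p φ‖ := by
  have e : ∀ ψ, IsTest ψ → inner ℂ (per p ψ) (per p ψ) =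
      ∫ y, perSum p ψ y * starRingEnd ℂ (ψ y) := fun ψ hψ => by
    rw [inner_per_test p hψ]
    refine integral_congr_ae ?_
    filter_upwards [perExt_per p hψ.1.continuous hψ.2] with y hy
    rw [hy]
  have : inner ℂ (per p fun y => φ (v + y)) (per p fun y => φ (v + y)) =
      inner ℂ (per p φ) (per p φ) := by
    rw [e _ h, e _ (h.translate v),
      ← integral_add_left_eq_self (fun y => perSum p φ y * starRingEnd ℂ (φ y)) v]
    refine integral_congr_ae (Eventually.of_forall fun y => ?_)
    have : perSum p (fun y => φ (v + y)) y = perSum p φ (v + y) :=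
      tsum_congr fun g => by rw [add_left_comm]
    simp only [this]
  rw [inner_self_eq_norm_sq_to_K, inner_self_eq_norm_sq_to_K] at this
  have h2 : ‖per p fun y => φ (v + y)‖ ^ 2 = ‖per p φ‖ ^ 2 := by exact_mod_cast this
  exact (sq_eq_sq₀ (norm_nonneg _) (norm_nonneg _)).1 h2

/-- The choice θ = 0 in the uniqueness of weak derivatives gives exactly this: periodized test
functions are total in L². -/
lemma eq_zero_of_inner_per {p : Periodicity} {X : L2per p}
    (h : ∀ φ, IsTest φ → inner ℂ (per p φ) X = 0) : X = 0 := by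
  refine HasD.eq_zero (θ := 0) ((hasD_iff_inner p 0 0 X).2 fun φ hφ => ?_)
  rw [h φ hφ, inner_zero_right, neg_zero]

/-- Integration by parts for translates of test functions. -/
lemma integral_mul_dirD {φ ψ : ℝ × ℝ → ℂ} (hφ : IsTest φ) (hψ : IsTest ψ) (θ : ℝ × ℝ) :
    ∫ y, φ y * dirD θ ψ y = -∫ y, dirD θ φ y * ψ y := by
  have hi : ∀ f g : ℝ × ℝ → ℂ, IsTest f → IsTest g → Integrable (fun y => f y * g y) volume :=
    fun f g hf hg => (hf.1.continuous.mul hg.1.continuous).integrable_of_hasCompactSupport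
      hf.2.mul_right
  exact integral_mul_fderiv_eq_neg_fderiv_mul_of_integrable (hi _ _ (hφ.dirD θ) hψ)
    (hi _ _ hφ (hψ.dirD θ)) (hi _ _ hφ hψ) (fun y _ => hφ.differentiable y)
    (fun y _ => hψ.differentiable y)

/-- Against a test function only finitely many translates contribute to the periodization; each can
be integrated by parts. -/
lemma hasD_per (p : Periodicity) (θ : ℝ × ℝ) {φ : ℝ × ℝ → ℂ} (hφ : IsTest φ) :
    HasD p θ (per p φ) (per p (dirD θ φ)) := by
  intro ψ h1 h2
  have hψ : IsTest ψ := ⟨h1, h2⟩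
  obtain ⟨r, hr⟩ := h2.isCompact.isBounded.subset_closedBall (0 : ℝ × ℝ)
  obtain ⟨S, hS⟩ := exists_finset_ball p r hφ.2
  have key : ∀ f g : ℝ × ℝ → ℂ, IsTest f → IsTest g → tsupport f ⊆ tsupport φ →
      tsupport g ⊆ tsupport ψ →
      ∫ y, perExt p (per p f) y * g y = ∑ k ∈ S, ∫ y, f (k + y) * g y := by
    intro f g hf hg hfφ hgψ
    rw [← integral_finsetSum]
    · refine integral_congr_ae ?_
      filter_upwards [perExt_per p hf.1.continuous hf.2] with y hy
      rw [hy]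
      by_cases hgy : g y = 0
      · simp [hgy]
      · have hyr : ‖y‖ ≤ r := by simpa using hr (hgψ (subset_tsupport g hgy))
        rw [perSum_eq_sum fun k hk => ?_, Finset.sum_mul]
        exact image_eq_zero_of_notMem_tsupport fun h => hS k hk y hyr (hfφ h)
    · intro k _
      exact ((hf.translate k).1.continuous.mul hg.1.continuous).integrable_of_hasCompactSupport
        (hg.2.mul_left)
  have e1 := key φ (dirD θ ψ) hφ (hψ.dirD θ) subset_rfl (tsupport_fderiv_apply_subset ℝ θ)
  have e2 := key (dirD θ φ) ψ (hφ.dirD θ) hψ (tsupport_fderiv_apply_subset ℝ θ) subset_rfl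
  rw [e2, ← Finset.sum_neg_distrib]
  refine e1.trans (Finset.sum_congr rfl fun k _ => ?_)
  rw [integral_mul_dirD (hφ.translate k) hψ]
  simp only [dirD_translate hφ]

/-! ### Skew-adjointness of D_θ -/

/-- The transport equation `D_θ X = a X` has no nontrivial solution for real `a ≠ 0`. -/
lemma eq_zero_of_hasD_smul {p : Periodicity} {θ : ℝ × ℝ} {a : ℝ} (ha : a ≠ 0) {X : L2per p}
    (h : HasD p θ X ((a : ℂ) • X)) : X = 0 := by
  refine eq_zero_of_inner_per fun φ hφ => ?_
  set ψ : ℝ × ℝ → ℂ := fun y => starRingEnd ℂ (φ (0 - y)) with hψdef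
  have hψ : IsTest ψ := (hφ.reflect 0).conj
  -- u(t) is X tested against φ translated by tθ. The equation for X gives u' = a u, while u is
  -- bounded because translation preserves ‖per φ‖. A bounded exponential with real rate a ≠ 0
  -- vanishes, and u(0) is the pairing with φ itself.
  set u : ℝ → ℂ := fun t => ∫ y, perExt p X y * ψ (t • θ - y) with hu
  have hd : ∀ t, HasDerivAt u (a * u t) t := by
    intro t
    have h1 := hψ.2.hasFDerivAt_convolution_right (μ := volume) (ContinuousLinearMap.mul ℝ ℂ)
      (locallyIntegrable_perExt p X) (hψ.1.of_le (by simp)) (t • θ)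
    have h2 : HasDerivAt (fun s : ℝ => s • θ) θ t := by
      simpa using (hasDerivAt_id t).smul_const θ
    have h3 := h1.comp_hasDerivAt t h2
    rw [convolution_precompR_apply _ (locallyIntegrable_perExt p X) (hψ.2.fderiv ℝ)
      (hψ.1.continuous_fderiv (by simp))] at h3
    have h4 := h _ (hψ.reflect (t • θ)).1 (hψ.reflect (t • θ)).2
    have h5 : ∫ y, perExt p X y * dirD θ ψ (t • θ - y) = a * u t := by
      have e1 : ∫ y, perExt p X y * fderiv ℝ (fun y => ψ (t • θ - y)) y θ =
          -∫ y, perExt p X y * dirD θ ψ (t • θ - y) := by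
        rw [← integral_neg]
        refine integral_congr_ae (Eventually.of_forall fun y => ?_)
        have := dirD_reflect hψ θ (t • θ) y
        simp only [dirD] at this ⊢
        rw [this, mul_neg]
      have e2 : ∫ y, perExt p ((a : ℂ) • X) y * ψ (t • θ - y) = a * u t := by
        rw [hu, ← integral_const_mul]
        refine integral_congr_ae ?_
        filter_upwards [perExt_smul p a X] with y hy
        rw [hy, mul_assoc]
      rw [e1, e2] at h4
      exact neg_injective h4
    rw [← h5]
    exact h3
  have hbd : ∀ t, ‖u t‖ ≤ ‖per p φ‖ * ‖X‖ := by
    intro t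
    have : u t = inner ℂ (per p fun y => φ (-(t • θ) + y)) X := by
      rw [inner_per_test p (hφ.translate _)]
      refine integral_congr_ae (Eventually.of_forall fun y => ?_)
      simp only [hψdef]
      congr 3
      abel
    rw [this, ← norm_per_translate p hφ (-(t • θ))]
    exact norm_inner_le_norm _ _
  have hexp : ∀ t, u t = Real.exp (a * t) * u 0 := by
    intro t
    have hc : ∀ s, HasDerivAt (fun s : ℝ => (Real.exp (-(a * s)) : ℂ) * u s) 0 s := by
      intro s
      have h1 : HasDerivAt (fun s : ℝ => Real.exp (-(a * s))) (Real.exp (-(a * s)) * -(a * 1)) s :=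
        (((hasDerivAt_id s).const_mul a).neg).exp
      have h2 := h1.ofReal_comp.mul (hd s)
      have e : ((Real.exp (-(a * s)) * -(a * 1) : ℝ) : ℂ) * u s +
          (Real.exp (-(a * s)) : ℂ) * (a * u s) = 0 := by
        push_cast
        ring
      exact e ▸ h2
    have hconst := is_const_of_deriv_eq_zero (fun s => (hc s).differentiableAt)
      (fun s => (hc s).deriv) t 0
    simp only [mul_zero, neg_zero, Real.exp_zero, Complex.ofReal_one, one_mul] at hconst
    rw [← hconst, ← mul_assoc, ← Complex.ofReal_mul, ← Real.exp_add]
    simp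
  have h0 : u 0 = 0 := by
    by_contra hne
    have h1 : ∀ n : ℕ, (n : ℝ) * ‖u 0‖ ≤ ‖per p φ‖ * ‖X‖ := by
      intro n
      -- At t = n/a the exponential is eⁿ ≥ n, whatever the sign of a.
      have h2 := hbd (n / a)
      rw [hexp, norm_mul, Complex.norm_real, Real.norm_eq_abs, Real.abs_exp,
        mul_div_cancel₀ _ ha] at h2
      refine le_trans ?_ h2
      gcongr
      linarith [Real.add_one_le_exp (n : ℝ)]
    obtain ⟨n, hn⟩ := exists_nat_gt (‖per p φ‖ * ‖X‖ / ‖u 0‖)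
    rw [div_lt_iff₀ (norm_pos_iff.2 hne)] at hn
    exact absurd (h1 n) (not_le.2 hn)
  rw [inner_per_test p hφ, ← h0]
  refine integral_congr_ae (Eventually.of_forall fun y => ?_)
  simp [hψdef]

/-- The core `{D_θ φ + φ}` is dense. -/
lemma exists_test_tendsto (p : Periodicity) (θ : ℝ × ℝ) (f : L2per p) :
    ∃ φ : ℕ → ℝ × ℝ → ℂ, (∀ n, IsTest (φ n)) ∧
      Tendsto (fun n => per p (dirD θ (φ n)) + per p (φ n)) atTop (𝓝 f) := by
  let R : Submodule ℂ (L2per p) :=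
    { carrier := {f | ∃ φ, IsTest φ ∧ per p (dirD θ φ) + per p φ = f}
      add_mem' := by
        rintro _ _ ⟨φ, hφ, rfl⟩ ⟨ψ, hψ, rfl⟩
        refine ⟨_, hφ.add hψ, ?_⟩
        rw [dirD_add hφ hψ, per_add p hφ hψ, per_add p (hφ.dirD θ) (hψ.dirD θ)]
        abel
      zero_mem' := by
        refine ⟨fun _ => 0, IsTest.zero, ?_⟩
        have h1 := per_const_mul p 0 IsTest.zero
        have h2 := dirD_const_mul 0 IsTest.zero θ
        simp only [zero_mul, zero_smul] at h1 h2
        rw [h2, h1, add_zero]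
      smul_mem' := by
        rintro c _ ⟨φ, hφ, rfl⟩
        refine ⟨_, hφ.const_mul c, ?_⟩
        rw [dirD_const_mul c hφ, per_const_mul p c hφ, per_const_mul p c (hφ.dirD θ), smul_add] }
  have hR : Dense (R : Set (L2per p)) := by
    rw [Submodule.dense_iff_topologicalClosure_eq_top, Submodule.topologicalClosure_eq_top_iff,
      Submodule.eq_bot_iff]
    intro x hx
    -- A vector x orthogonal to all D_θ φ + φ satisfies D_θ x = x weakly.
    refine eq_zero_of_hasD_smul (θ := θ) one_ne_zero ((hasD_iff_inner p θ _ _).2 fun φ hφ => ?_)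
    have h1 := (Submodule.mem_orthogonal _ _).1 hx _ ⟨φ, hφ, rfl⟩
    rw [inner_add_left] at h1
    rw [Complex.ofReal_one, one_smul]
    linear_combination h1
  obtain ⟨x, hx, hxf⟩ := mem_closure_iff_seq_limit.1 (hR f)
  choose φ hφ hφx using hx
  exact ⟨φ, hφ, by simpa only [hφx] using hxf⟩

/-- `D_θ` on periodic functions is skew-adjoint. -/
lemma isSkewAdjointRel_hasD (p : Periodicity) (θ : ℝ × ℝ) : IsSkewAdjointRel (HasD p θ) := by
  intro U W
  constructor
  swap
  · intro h
    refine (hasD_iff_inner p θ U W).2 fun φ hφ => ?_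
    rw [h _ _ (hasD_per p θ hφ), neg_neg]
  intro hUW P Q hPQ
  -- The pair (P, Q) is to be approximated in graph norm by periodized test functions; the
  -- definition of the weak derivative of U then passes to the limit. Choose φₙ with D_θ φₙ + φₙ → Q
  -- + P. As D_θ is skew on test functions, ‖ψ‖ ≤ ‖D_θ ψ + ψ‖, so the periodizations of φₙ converge
  -- to some X with D_θ X = Q + P - X.
  obtain ⟨φ, hφ, hlim⟩ := exists_test_tendsto p θ (Q + P)
  have hnorm : ∀ ψ, IsTest ψ → ‖per p ψ‖ ^ 2 ≤ ‖per p (dirD θ ψ) + per p ψ‖ ^ 2 := by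
    intro ψ hψ
    have h1 := (hasD_iff_inner p θ _ _).1 (hasD_per p θ hψ) ψ hψ
    have h2 : RCLike.re (inner ℂ (per p (dirD θ ψ)) (per p ψ)) = 0 := by
      have h3 := congrArg RCLike.re h1
      rw [map_neg, inner_re_symm (per p ψ)] at h3
      linarith
    rw [norm_add_sq (𝕜 := ℂ), h2]
    nlinarith [sq_nonneg ‖per p (dirD θ ψ)‖]
  have hdiff : ∀ ψ χ, IsTest ψ → IsTest χ → ‖per p ψ - per p χ‖ ≤
      ‖(per p (dirD θ ψ) + per p ψ) - (per p (dirD θ χ) + per p χ)‖ := by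
    intro ψ χ hψ hχ
    have h1 := hnorm _ (hψ.add (hχ.const_mul (-1)))
    rw [dirD_add hψ (hχ.const_mul (-1)), dirD_const_mul _ hχ, per_add p hψ (hχ.const_mul (-1)),
      per_add p (hψ.dirD θ) ((hχ.dirD θ).const_mul (-1)), per_const_mul p _ hχ,
      per_const_mul p _ (hχ.dirD θ), neg_one_smul, neg_one_smul,
      sq_le_sq₀ (norm_nonneg _) (norm_nonneg _)] at h1
    have e : per p (dirD θ ψ) + per p ψ - (per p (dirD θ χ) + per p χ) =
        per p (dirD θ ψ) + -per p (dirD θ χ) + (per p ψ + -per p χ) := by abel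
    rw [e, sub_eq_add_neg]
    exact h1
  have hcau : CauchySeq fun n => per p (φ n) := by
    have h1 := hlim.cauchySeq
    rw [Metric.cauchySeq_iff] at h1 ⊢
    intro ε hε
    obtain ⟨N, hN⟩ := h1 ε hε
    refine ⟨N, fun m hm n hn => lt_of_le_of_lt ?_ (hN m hm n hn)⟩
    rw [dist_eq_norm, dist_eq_norm]
    exact hdiff _ _ (hφ m) (hφ n)
  obtain ⟨X, hX⟩ := cauchySeq_tendsto_of_complete hcau
  have hY : Tendsto (fun n => per p (dirD θ (φ n))) atTop (𝓝 (Q + P - X)) :=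
    (hlim.sub hX).congr fun n => by abel
  have hXY : HasD p θ X (Q + P - X) := by
    rw [hasD_iff_inner]
    intro ψ hψ
    refine tendsto_nhds_unique (tendsto_const_nhds.inner (𝕜 := ℂ) hX) ?_
    refine (tendsto_const_nhds.inner (𝕜 := ℂ) hY).neg.congr fun n => ?_
    exact ((hasD_iff_inner p θ _ _).1 (hasD_per p θ (hφ n)) ψ hψ).symm
  -- The difference X - P solves D_θ Y = -Y, hence vanishes.
  have hXP : X = P := by
    have h1 := hXY.add (hPQ.smul (-1))
    have h2 := eq_zero_of_hasD_smul (a := -1) (by norm_num) (X := X + (-1 : ℂ) • P) (by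
      convert h1 using 1
      push_cast
      module)
    rw [neg_one_smul, ← sub_eq_add_neg] at h2
    exact sub_eq_zero.1 h2
  subst hXP
  rw [add_sub_cancel_right] at hY
  refine tendsto_nhds_unique (hX.inner (𝕜 := ℂ) tendsto_const_nhds) ?_
  refine (hY.inner (𝕜 := ℂ) tendsto_const_nhds).neg.congr fun n => ?_
  rw [(hasD_iff_inner p θ _ _).1 hUW _ (hφ n), neg_neg]

/-! ### Multiplication operators and the graph of the operator -/

lemma memLp_mul (p : Periodicity) (m : ℝ × ℝ →ᵇ ℂ) (U : L2per p) :
    MemLp (fun y => m y * U y) 2 (volume.restrict (cell p)) :=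
  (Lp.memLp U).of_le_mul (c := ‖m‖)
    (m.continuous.aestronglyMeasurable.mul (Lp.memLp U).aestronglyMeasurable)
    (Eventually.of_forall fun y => by
      rw [norm_mul]
      gcongr
      exact m.norm_coe_le_norm y)

/-- Multiplication by a bounded continuous function. -/
def mulL (p : Periodicity) (m : ℝ × ℝ →ᵇ ℂ) : L2per p →L[ℂ] L2per p :=
  LinearMap.mkContinuous
    { toFun := fun U => (memLp_mul p m U).toLp
      map_add' := fun U V => by
        refine Lp.ext ?_
        filter_upwards [(memLp_mul p m (U + V)).coeFn_toLp, (memLp_mul p m U).coeFn_toLp,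
          (memLp_mul p m V).coeFn_toLp, Lp.coeFn_add U V,
          Lp.coeFn_add (memLp_mul p m U).toLp (memLp_mul p m V).toLp] with y h1 h2 h3 h4 h5
        rw [h1, h5, Pi.add_apply, h2, h3, h4, Pi.add_apply, mul_add]
      map_smul' := fun c U => by
        refine Lp.ext ?_
        filter_upwards [(memLp_mul p m (c • U)).coeFn_toLp, (memLp_mul p m U).coeFn_toLp,
          Lp.coeFn_smul c U, Lp.coeFn_smul c (memLp_mul p m U).toLp] with y h1 h2 h3 h4
        rw [h1, RingHom.id_apply, h4, Pi.smul_apply, h2, h3, Pi.smul_apply, smul_eq_mul,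
          smul_eq_mul]
        ring }
    ‖m‖ fun U => by
      refine Lp.norm_le_mul_norm_of_ae_le_mul ?_
      filter_upwards [(memLp_mul p m U).coeFn_toLp] with y h
      rw [LinearMap.coe_mk, AddHom.coe_mk, h, norm_mul]
      gcongr
      exact m.norm_coe_le_norm y

lemma coeFn_mulL (p : Periodicity) (m : ℝ × ℝ →ᵇ ℂ) (U : L2per p) :
    mulL p m U =ᵐ[volume.restrict (cell p)] fun y => m y * U y :=
  (memLp_mul p m U).coeFn_toLp

lemma norm_sq_L2per (p : Periodicity) (U : L2per p) : ‖U‖ ^ 2 = ∫ y in cell p, ‖U y‖ ^ 2 := by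
  have h := L2.inner_def (𝕜 := ℂ) U U
  rw [inner_self_eq_norm_sq_to_K] at h
  have e : ∀ y, inner ℂ (U y) (U y) = ((‖U y‖ ^ 2 : ℝ) : ℂ) := fun y => by
    rw [inner_self_eq_norm_sq_to_K]; norm_cast
  simp only [e] at h
  rw [integral_complex_ofReal] at h
  refine Complex.ofReal_injective (Eq.trans ?_ h)
  push_cast
  rfl

lemma integrable_norm_sq (p : Periodicity) (U : L2per p) :
    Integrable (fun y => ‖U y‖ ^ 2) (volume.restrict (cell p)) :=
  (Lp.memLp U).integrable_norm_pow (by norm_num)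

lemma norm_mulL_of_norm_eq_one (p : Periodicity) {m : ℝ × ℝ →ᵇ ℂ} (hm : ∀ y, ‖m y‖ = 1)
    (U : L2per p) : ‖mulL p m U‖ = ‖U‖ := by
  rw [← sq_eq_sq₀ (norm_nonneg _) (norm_nonneg _), norm_sq_L2per, norm_sq_L2per]
  refine integral_congr_ae ?_
  filter_upwards [coeFn_mulL p m U] with y h
  rw [h, norm_mul, hm, one_mul]

lemma mulL_comm (p : Periodicity) (m m' : ℝ × ℝ →ᵇ ℂ) (U : L2per p) :
    mulL p m (mulL p m' U) = mulL p m' (mulL p m U) := by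
  refine Lp.ext ?_
  filter_upwards [coeFn_mulL p m (mulL p m' U), coeFn_mulL p m' (mulL p m U), coeFn_mulL p m U,
    coeFn_mulL p m' U] with y h1 h2 h3 h4
  rw [h1, h2, h3, h4]
  ring

lemma inner_mulL_left {p : Periodicity} {m : ℝ × ℝ →ᵇ ℂ} (hm : ∀ y, starRingEnd ℂ (m y) = m y)
    (U V : L2per p) : inner ℂ (mulL p m U) V = inner ℂ U (mulL p m V) := by
  rw [L2.inner_def, L2.inner_def]
  refine integral_congr_ae ?_
  filter_upwards [coeFn_mulL p m U, coeFn_mulL p m V] with y h1 h2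
  rw [h1, h2, RCLike.inner_apply, RCLike.inner_apply, map_mul, hm]
  ring

lemma le_re_inner_mulL {p : Periodicity} {m : ℝ × ℝ →ᵇ ℂ} {f : ℝ × ℝ → ℝ} {c : ℝ}
    (hm : ∀ y, m y = f y) (hf : ∀ y, c ≤ f y) (U : L2per p) :
    c * ‖U‖ ^ 2 ≤ (inner ℂ U (mulL p m U)).re := by
  have h1 : (inner ℂ U (mulL p m U)).re = ∫ y in cell p, (inner ℂ (U y) (mulL p m U y)).re := by
    rw [L2.inner_def]
    exact (integral_re (𝕜 := ℂ) (L2.integrable_inner U (mulL p m U))).symm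
  rw [h1, norm_sq_L2per, ← integral_const_mul]
  refine integral_mono_ae ((integrable_norm_sq p U).const_mul c)
    (L2.integrable_inner (𝕜 := ℂ) U (mulL p m U)).re ?_
  filter_upwards [coeFn_mulL p m U] with y h
  have : inner ℂ (U y) (m y * U y) = ((f y * ‖U y‖ ^ 2 : ℝ) : ℂ) := by
    rw [RCLike.inner_apply, hm, mul_assoc, Complex.mul_conj, Complex.normSq_eq_norm_sq]
    push_cast
    ring
  rw [h, this, Complex.ofReal_re]
  gcongr
  exact hf y

/-- Invariance under the periods. -/
def IsPer (p : Periodicity) (m : ℝ × ℝ → ℂ) : Prop := ∀ y, m (fold p y) = m y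

lemma perExt_mulL {p : Periodicity} {m : ℝ × ℝ →ᵇ ℂ} (hm : IsPer p m) (U : L2per p) :
    perExt p (mulL p m U) =ᵐ[volume] fun y => m y * perExt p U y := by
  filter_upwards [(quasiMeasurePreserving_fold p).ae (coeFn_mulL p m U)] with y h
  rw [perExt, h, hm, perExt]

/-- Use χφ as test function. The statement concerns functions on the plane and χ need not be
periodic, so it also covers cutoffs that take a doubly periodic function to the cylinder. -/
lemma HasWeakDirDeriv.mul {θ : ℝ × ℝ} {u w χ : ℝ × ℝ → ℂ} (h : HasWeakDirDeriv θ u w)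
    (hu : LocallyIntegrable u volume) (hw : LocallyIntegrable w volume) (hχ : ContDiff ℝ ∞ χ) :
    HasWeakDirDeriv θ (fun y => χ y * u y) (fun y => χ y * w y + dirD θ χ y * u y) := by
  intro φ h1 h2
  have hχφ : IsTest fun y => χ y * φ y := ⟨hχ.mul h1, h2.mul_left⟩
  have hD : Continuous (dirD θ χ) := (hχ.continuous_fderiv (by simp)).clm_apply continuous_const
  have e := h _ hχφ.1 hχφ.2
  have e1 : ∀ y, fderiv ℝ (fun y => χ y * φ y) y θ =
      χ y * fderiv ℝ φ y θ + dirD θ χ y * φ y := fun y => by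
    have := ((hχ.differentiable (by simp)) y).hasFDerivAt.mul
      ((h1.differentiable (by simp)) y).hasFDerivAt
    refine (DFunLike.congr_fun this.fderiv θ).trans ?_
    simp [dirD, mul_comm]
  have hi : ∀ (v g : ℝ × ℝ → ℂ), LocallyIntegrable v volume → Continuous g →
      HasCompactSupport g → Integrable (fun y => v y * g y) volume := fun v g hv hg hs =>
    (hv.integrable_smul_left_of_hasCompactSupport hg hs).congr
      (Eventually.of_forall fun y => by simp [mul_comm])
  have hφ' : Continuous fun y => fderiv ℝ φ y θ :=
    (h1.continuous_fderiv (by simp)).clm_apply continuous_const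
  have i1 := hi u (fun y => χ y * fderiv ℝ φ y θ) hu (hχ.continuous.mul hφ')
    (h2.fderiv_apply ℝ θ).mul_left
  have i2 := hi u (fun y => dirD θ χ y * φ y) hu (hD.mul h1.continuous) h2.mul_left
  have i3 := hi w (fun y => χ y * φ y) hw (hχ.continuous.mul h1.continuous) h2.mul_left
  simp only [e1, mul_add] at e
  rw [integral_add i1 i2] at e
  have e2 : ∫ y, χ y * u y * fderiv ℝ φ y θ = ∫ y, u y * (χ y * fderiv ℝ φ y θ) :=
    integral_congr_ae (Eventually.of_forall fun y => by simp only; ring)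
  have e3 : ∫ y, (χ y * w y + dirD θ χ y * u y) * φ y =
      (∫ y, w y * (χ y * φ y)) + ∫ y, u y * (dirD θ χ y * φ y) := by
    rw [← integral_add i3 i2]
    exact integral_congr_ae (Eventually.of_forall fun y => by simp only; ring)
  rw [e2, e3]
  linear_combination e

lemma HasWeakDirDeriv.congr {θ : ℝ × ℝ} {u w u' w' : ℝ × ℝ → ℂ} (h : HasWeakDirDeriv θ u w)
    (hu : u' =ᵐ[volume] u) (hw : w' =ᵐ[volume] w) : HasWeakDirDeriv θ u' w' := by
  intro φ h1 h2
  have e1 : ∫ y, u' y * fderiv ℝ φ y θ = ∫ y, u y * fderiv ℝ φ y θ :=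
    integral_congr_ae (by filter_upwards [hu] with y hy; rw [hy])
  have e2 : ∫ y, w' y * φ y = ∫ y, w y * φ y :=
    integral_congr_ae (by filter_upwards [hw] with y hy; rw [hy])
  rw [e1, e2]
  exact h φ h1 h2

lemma HasD.mulL {p : Periodicity} {θ : ℝ × ℝ} {m m' : ℝ × ℝ →ᵇ ℂ} (hm : IsPer p m)
    (hm' : IsPer p m') (hd : ContDiff ℝ ∞ m) (hmm' : ∀ y, m' y = dirD θ m y) {U W : L2per p}
    (h : HasD p θ U W) : HasD p θ (mulL p m U) (mulL p m W + mulL p m' U) := by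
  refine (HasWeakDirDeriv.mul h (locallyIntegrable_perExt p U) (locallyIntegrable_perExt p W)
    hd).congr (perExt_mulL hm U) ?_
  filter_upwards [perExt_add p (QuasiPeriodic.mulL p m W) (QuasiPeriodic.mulL p m' U),
    perExt_mulL hm W, perExt_mulL hm' U] with y h1 h2 h3
  rw [h1, h2, h3, hmm']

/-- Dividing by μ and multiplying by ρ puts the graph in the form required by
`mem_resolventSetOp_iff_systemBound`, with coefficients μ⁻¹ and ρ. -/
lemma mem_graph_op_iff {p : Periodicity} {θ : ℝ × ℝ} {μ ρ : ℝ × ℝ → ℝ} {κ : ℂ}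
    {m r : ℝ × ℝ →ᵇ ℂ} (hm : ∀ y, m y = (μ y : ℂ)⁻¹) (hr : ∀ y, r y = ρ y)
    (hμ : ∀ y, μ y ≠ 0) (hρ : ∀ y, ρ y ≠ 0) (U F : L2per p) :
    (U, F) ∈ (op p θ μ ρ κ).graph ↔ ∃ W P Q, HasD p θ U W ∧ mulL p m P = W + κ • U ∧
      HasD p θ P Q ∧ mulL p r F = -(Q + κ • P) := by
  have hμ' : ∀ y, (μ y : ℂ) ≠ 0 := fun y => by exact_mod_cast hμ y
  have hρ' : ∀ y, (ρ y : ℂ) ≠ 0 := fun y => by exact_mod_cast hρ y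
  rw [graph_op]
  change (∃ W P Q : L2per p, _) ↔ _
  refine exists_congr fun W => exists_congr fun P => exists_congr fun Q => ?_
  refine and_congr_right fun _ => and_congr ?_ (and_congr_right fun _ => ?_)
  · constructor
    · intro h
      refine Lp.ext ?_
      filter_upwards [h, coeFn_mulL p m P, Lp.coeFn_add W (κ • U), Lp.coeFn_smul κ U]
        with y h1 h2 h3 h4
      rw [h2, h3, Pi.add_apply, h4, Pi.smul_apply, hm, h1, inv_mul_cancel_left₀ (hμ' y),
        smul_eq_mul]
    · intro h
      have h0 : mulL p m P =ᵐ[volume.restrict (cell p)] (W + κ • U : L2per p) := by rw [h]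
      filter_upwards [h0, coeFn_mulL p m P, Lp.coeFn_add W (κ • U), Lp.coeFn_smul κ U]
        with y h1 h2 h3 h4
      rw [h2, h3, Pi.add_apply, h4, Pi.smul_apply, hm, smul_eq_mul] at h1
      rw [← h1, mul_inv_cancel_left₀ (hμ' y)]
  · constructor
    · intro h
      refine Lp.ext ?_
      filter_upwards [h, coeFn_mulL p r F, Lp.coeFn_neg (Q + κ • P), Lp.coeFn_add Q (κ • P),
        Lp.coeFn_smul κ P] with y h1 h2 h3 h4 h5
      rw [h2, h3, Pi.neg_apply, h4, Pi.add_apply, h5, Pi.smul_apply, hr, h1, mul_neg,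
        mul_inv_cancel_left₀ (hρ' y), smul_eq_mul]
    · intro h
      have h0 : mulL p r F =ᵐ[volume.restrict (cell p)] (-(Q + κ • P) : L2per p) := by rw [h]
      filter_upwards [h0, coeFn_mulL p r F, Lp.coeFn_neg (Q + κ • P), Lp.coeFn_add Q (κ • P),
        Lp.coeFn_smul κ P] with y h1 h2 h3 h4 h5
      rw [h2, h3, Pi.neg_apply, h4, Pi.add_apply, h5, Pi.smul_apply, hr, smul_eq_mul] at h1
      rw [← mul_neg, ← h1, inv_mul_cancel_left₀ (hρ' y)]

/-! ### Characters and independence of the quasi-momentum -/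

/-- The character `y ↦ exp (i a · y)`. -/
def charB (a : ℝ × ℝ) : ℝ × ℝ →ᵇ ℂ :=
  BoundedContinuousFunction.ofNormedAddCommGroup
    (fun y => Complex.exp (((a.1 * y.1 + a.2 * y.2 : ℝ) : ℂ) * Complex.I)) (by fun_prop) 1
    fun y => (Complex.norm_exp_ofReal_mul_I _).le

lemma charB_apply (a y : ℝ × ℝ) :
    charB a y = Complex.exp (((a.1 * y.1 + a.2 * y.2 : ℝ) : ℂ) * Complex.I) := rfl

lemma norm_charB (a y : ℝ × ℝ) : ‖charB a y‖ = 1 := Complex.norm_exp_ofReal_mul_I _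

lemma contDiff_charB (a : ℝ × ℝ) : ContDiff ℝ ∞ (charB a) := by
  change ContDiff ℝ ∞ fun y : ℝ × ℝ => Complex.exp (((a.1 * y.1 + a.2 * y.2 : ℝ) : ℂ) * Complex.I)
  refine ContDiff.cexp (ContDiff.mul ?_ contDiff_const)
  exact Complex.ofRealCLM.contDiff.comp ((contDiff_const.mul contDiff_fst).add
    (contDiff_const.mul contDiff_snd))

lemma dirD_charB (θ a y : ℝ × ℝ) :
    dirD θ (charB a) y = (((a.1 * θ.1 + a.2 * θ.2 : ℝ) : ℂ) * Complex.I) * charB a y := by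
  have h1 : HasFDerivAt (fun y : ℝ × ℝ => a.1 * y.1 + a.2 * y.2)
      (a.1 • ContinuousLinearMap.fst ℝ ℝ ℝ + a.2 • ContinuousLinearMap.snd ℝ ℝ ℝ) y :=
    (hasFDerivAt_fst.const_mul a.1).add (hasFDerivAt_snd.const_mul a.2)
  have h2 := ((Complex.ofRealCLM.hasFDerivAt.comp y h1).mul_const Complex.I).cexp
  refine (DFunLike.congr_fun h2.fderiv θ).trans ?_
  simp [charB_apply]
  ring

/-- The character is an eigenfunction of D_θ with eigenvalue i a·θ, so conjugating D_θ by it adds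
this constant. -/
lemma HasD.charB {p : Periodicity} {θ a : ℝ × ℝ} (ha : IsPer p (charB a)) {U W : L2per p}
    (h : HasD p θ U W) : HasD p θ (QuasiPeriodic.mulL p (charB a) U)
      (QuasiPeriodic.mulL p (charB a)
        (W + (((a.1 * θ.1 + a.2 * θ.2 : ℝ) : ℂ) * Complex.I) • U)) := by
  set β : ℂ := ((a.1 * θ.1 + a.2 * θ.2 : ℝ) : ℂ) * Complex.I with hβ
  have h1 := HasD.mulL (m' := β • QuasiPeriodic.charB a) ha (fun y => by simp [ha y])
    (contDiff_charB a) (fun y => by rw [dirD_charB]; rfl) h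
  have h2 : QuasiPeriodic.mulL p (β • QuasiPeriodic.charB a) U =
      β • QuasiPeriodic.mulL p (QuasiPeriodic.charB a) U := by
    refine Lp.ext ?_
    filter_upwards [coeFn_mulL p (β • QuasiPeriodic.charB a) U,
      coeFn_mulL p (QuasiPeriodic.charB a) U,
      Lp.coeFn_smul β (QuasiPeriodic.mulL p (QuasiPeriodic.charB a) U)] with y e1 e2 e3
    rw [e1, e3, Pi.smul_apply, e2]
    simp [mul_assoc]
  rwa [h2, ← map_smul, ← map_add] at h1

/-- Multiplication by a periodic character shifts the quasi-momentum. -/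
lemma SystemBound.shift {p : Periodicity} {θ a : ℝ × ℝ} (ha : IsPer p (charB a))
    {m r : ℝ × ℝ →ᵇ ℂ} {z κ : ℂ} {c : ℝ} (h : SystemBound (HasD p θ) (mulL p m) (mulL p r) z κ c) :
    SystemBound (HasD p θ) (mulL p m) (mulL p r) z
      (κ + ((a.1 * θ.1 + a.2 * θ.2 : ℝ) : ℂ) * Complex.I) c := by
  set β : ℂ := ((a.1 * θ.1 + a.2 * θ.2 : ℝ) : ℂ) * Complex.I with hβ
  intro U W P Q hUW hPQ
  have h1 := h _ _ _ _ (hUW.charB ha) (hPQ.charB ha)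
  have e1 : mulL p (charB a) (W + β • U) + κ • mulL p (charB a) U -
      mulL p m (mulL p (charB a) P) = mulL p (charB a) (W + (κ + β) • U - mulL p m P) := by
    rw [mulL_comm, ← map_smul, ← map_add, ← map_sub]
    congr 1
    module
  have e2 : mulL p (charB a) (Q + β • P) + κ • mulL p (charB a) P +
      z • mulL p r (mulL p (charB a) U) =
      mulL p (charB a) (Q + (κ + β) • P + z • mulL p r U) := by
    rw [mulL_comm, ← map_smul, ← map_smul, ← map_add, ← map_add]
    congr 1
    module
  rw [e1, e2] at h1
  simpa only [norm_mulL_of_norm_eq_one p (norm_charB a)] using h1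

lemma isPer_charB (k l : ℤ) :
    IsPer .both (charB (2 * Real.pi * k, 2 * Real.pi * l)) := by
  intro y
  rw [charB_apply, charB_apply, Complex.exp_eq_exp_iff_exists_int]
  refine ⟨-(k * ⌊y.1⌋ + l * ⌊y.2⌋), ?_⟩
  simp only [fold, shift, Prod.fst_sub, Prod.snd_sub]
  push_cast
  ring

/-- Lower bounds on the torus do not depend on the quasi-momentum. -/
lemma SystemBound.of_irrational {θ : ℝ × ℝ} (hθ : Irrational (θ.1 / θ.2)) {m r : ℝ × ℝ →ᵇ ℂ}
    {z : ℂ} {s : ℝ} {c : ℝ}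
    (h : SystemBound (HasD .both θ) (mulL .both m) (mulL .both r) z (s * Complex.I) c) (t : ℝ) :
    SystemBound (HasD .both θ) (mulL .both m) (mulL .both r) z (t * Complex.I) c := by
  intro U W P Q hUW hPQ
  -- G is the group of shifts of the quasi-momentum realised by doubly periodic characters;
  -- irrationality makes it dense.
  set G : AddSubgroup ℝ := AddSubgroup.closure {2 * Real.pi * θ.1, 2 * Real.pi * θ.2} with hG
  have hdense : Dense (G : Set ℝ) := by
    rw [hG, dense_addSubgroupClosure_pair_iff, mul_div_mul_left _ _ (by positivity)]
    exact hθ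
  -- For fixed U, W, P, Q both sides of the bound are continuous in the shift, so validity on G
  -- extends to its closure.
  let S : Set ℝ := {x | c * (‖U‖ ^ 2 + ‖P‖ ^ 2) ≤
    ‖W + (((s + x : ℝ) : ℂ) * Complex.I) • U - mulL .both m P‖ ^ 2 +
      ‖Q + (((s + x : ℝ) : ℂ) * Complex.I) • P + z • mulL .both r U‖ ^ 2}
  have hS : IsClosed S := isClosed_le continuous_const (by fun_prop)
  have hGS : (G : Set ℝ) ⊆ S := by
    intro x hx
    obtain ⟨k, l, rfl⟩ := AddSubgroup.mem_closure_pair.1 hx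
    have h1 := h.shift (isPer_charB k l) U W P Q hUW hPQ
    have e : (s : ℂ) * Complex.I + ((2 * Real.pi * k * θ.1 + 2 * Real.pi * l * θ.2 : ℝ) : ℂ) *
        Complex.I = ((s + (k • (2 * Real.pi * θ.1) + l • (2 * Real.pi * θ.2)) : ℝ) : ℂ) *
        Complex.I := by
      push_cast [zsmul_eq_mul]
      ring
    simp only [e] at h1
    exact h1
  have h2 : t - s ∈ S := (hS.closure_subset_iff.2 hGS) (hdense (t - s))
  simpa [S] using h2

/-! ### The coefficients on the whole plane -/

/-- A lower bound along the line `ℝ θ` holds everywhere. -/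
lemma le_of_le_on_line {θ : ℝ × ℝ} (hθ : Irrational (θ.1 / θ.2)) {f : ℝ × ℝ → ℝ}
    (hf : Continuous f) (h1 : ∀ y : ℝ × ℝ, f (y.1 + 1, y.2) = f y)
    (h2 : ∀ y : ℝ × ℝ, f (y.1, y.2 + 1) = f y) {c : ℝ} (hc : ∀ x : ℝ, c ≤ f (x • θ))
    (y : ℝ × ℝ) : c ≤ f y := by
  have hθ2 : θ.2 ≠ 0 := by
    rintro h
    rw [h, div_zero] at hθ
    exact hθ ⟨0, by simp⟩
  have p1 : ∀ (b : ℝ), Function.Periodic (fun a => f (a, b)) 1 := fun b a => h1 (a, b)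
  have p2 : ∀ (a : ℝ), Function.Periodic (fun b => f (a, b)) 1 := fun a b => h2 (a, b)
  -- Modulo periods, the line ℝθ meets the height y.2 at first coordinates y.2 · δ + kδ + l with δ =
  -- θ.1 / θ.2. The parameter (y.2 + k) / θ.2 reaches height y.2 + k.
  set G : AddSubgroup ℝ := AddSubgroup.closure {θ.1 / θ.2, 1} with hG
  have hdense : Dense (G : Set ℝ) := by
    rw [hG, dense_addSubgroupClosure_pair_iff, div_one]
    exact hθ
  let S : Set ℝ := {x | c ≤ f (y.2 * (θ.1 / θ.2) + x, y.2)}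
  have hS : IsClosed S := isClosed_le continuous_const (by fun_prop)
  have hGS : (G : Set ℝ) ⊆ S := by
    intro x hx
    obtain ⟨k, l, rfl⟩ := AddSubgroup.mem_closure_pair.1 hx
    have h3 := hc ((y.2 + k) / θ.2)
    have e1 : ((y.2 + k) / θ.2) • θ = (y.2 * (θ.1 / θ.2) + k * (θ.1 / θ.2), y.2 + k * 1) := by
      ext
      · simp only [Prod.smul_fst, smul_eq_mul]; ring
      · simp only [Prod.smul_snd, smul_eq_mul]; field_simp
    rw [e1] at h3
    have e2 := (p2 (y.2 * (θ.1 / θ.2) + k * (θ.1 / θ.2))).int_mul k y.2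
    have e3 := (p1 y.2).int_mul l (y.2 * (θ.1 / θ.2) + k * (θ.1 / θ.2))
    rw [e2, ← e3, add_assoc] at h3
    simpa [S] using h3
  have h3 : y.1 - y.2 * (θ.1 / θ.2) ∈ S := (hS.closure_subset_iff.2 hGS) (hdense _)
  simpa [S] using h3

lemma eq_fold_of_periodic {f : ℝ × ℝ → ℝ} (h1 : ∀ y : ℝ × ℝ, f (y.1 + 1, y.2) = f y)
    (h2 : ∀ y : ℝ × ℝ, f (y.1, y.2 + 1) = f y) (p : Periodicity) (y : ℝ × ℝ) :
    f (fold p y) = f y := by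
  have p1 : ∀ (b : ℝ), Function.Periodic (fun a => f (a, b)) 1 := fun b a => h1 (a, b)
  have p2 : ∀ (a : ℝ), Function.Periodic (fun b => f (a, b)) 1 := fun a b => h2 (a, b)
  have e1 : ∀ (n : ℤ) (a b : ℝ), f (a - n, b) = f (a, b) := fun n a b => by
    simpa using (p1 b).sub_int_mul_eq n (x := a)
  have e2 : ∀ (n : ℤ) (a b : ℝ), f (a, b - n) = f (a, b) := fun n a b => by
    simpa using (p2 a).sub_int_mul_eq n (x := b)
  have h : fold p y = (y.1 - (shift p y).1, y.2 - (shift p y).2) := rfl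
  rw [h, e1, e2]

lemma exists_abs_le_of_periodic {f : ℝ × ℝ → ℝ} (hf : Continuous f)
    (h1 : ∀ y : ℝ × ℝ, f (y.1 + 1, y.2) = f y)
    (h2 : ∀ y : ℝ × ℝ, f (y.1, y.2 + 1) = f y) : ∃ C, ∀ y, |f y| ≤ C := by
  obtain ⟨C, hC⟩ := (isCompact_Icc (a := (0 : ℝ)) (b := 1)).prod
    (isCompact_Icc (a := (0 : ℝ)) (b := 1)) |>.exists_bound_of_continuousOn hf.continuousOn
  refine ⟨C, fun y => ?_⟩
  rw [← eq_fold_of_periodic h1 h2 .both y]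
  have h := fold_mem_cell .both y
  exact hC _ ⟨Ico_subset_Icc_self h.1, Ico_subset_Icc_self h.2⟩

/-! ### Strips, cutoffs, and the passage from the cylinder to the torus -/

/-- The part `[0,1) × [-N,N)` of the cylinder. -/
def strip (N : ℕ) : Set (ℝ × ℝ) := Ico 0 1 ×ˢ Ico (-(N : ℝ)) N

lemma measurableSet_strip (N : ℕ) : MeasurableSet (strip N) :=
  measurableSet_Ico.prod measurableSet_Ico

lemma strip_subset_cell (N : ℕ) : strip N ⊆ cell .first := prod_mono_right (subset_univ _)

/-- The translation by `n` in the second variable. -/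
def up (n : ℤ) (y : ℝ × ℝ) : ℝ × ℝ := y + (0, (n : ℝ))

lemma measurePreserving_up (n : ℤ) : MeasurePreserving (up n) volume volume :=
  measurePreserving_add_right volume _

lemma measurableEmbedding_up (n : ℤ) : MeasurableEmbedding (up n) :=
  (MeasurableEquiv.addRight ((0 : ℝ), (n : ℝ))).measurableEmbedding

lemma up_eq_add_lat (n : ℤ) (y : ℝ × ℝ) : ∃ g ∈ lat .both, up n y = g + y :=
  ⟨(0, (n : ℝ)), ⟨0, n, by simp, by simp⟩, add_comm _ _⟩

lemma perExt_up (n : ℤ) (U : L2per .both) (y : ℝ × ℝ) :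
    perExt .both U (up n y) = perExt .both U y := by
  obtain ⟨g, hg, h⟩ := up_eq_add_lat n y
  rw [h, perExt_add_lat hg]

lemma up_preimage_cell (n : ℤ) :
    up n ⁻¹' (Ico 0 1 ×ˢ Ico (n : ℝ) (n + 1)) = cell .both := by
  ext y
  simp only [up, cell, mem_preimage, mem_prod, mem_Ico, Prod.fst_add, Prod.snd_add, add_zero]
  constructor <;> rintro ⟨h, h1, h2⟩ <;> exact ⟨h, by linarith, by linarith⟩

lemma strip_eq_biUnion (N : ℕ) :
    strip N = ⋃ n ∈ Finset.Ico (-(N : ℤ)) N, Ico (0 : ℝ) 1 ×ˢ Ico (n : ℝ) (n + 1) := by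
  ext y
  simp only [strip, mem_iUnion, mem_prod, mem_Ico, Finset.mem_Ico]
  constructor
  · rintro ⟨h, h1, h2⟩
    refine ⟨⌊y.2⌋, ⟨Int.le_floor.2 (by push_cast; exact h1), Int.floor_lt.2 (by exact_mod_cast h2)⟩,
      h, Int.floor_le _, Int.lt_floor_add_one _⟩
  · rintro ⟨n, ⟨h1, h2⟩, h, h3, h4⟩
    have h1' : (-(N : ℝ)) ≤ n := by exact_mod_cast h1
    have h2' : (n : ℝ) + 1 ≤ N := by exact_mod_cast h2
    exact ⟨h, by linarith, by linarith⟩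

lemma integrableOn_strip {f : ℝ × ℝ → ℝ} {N : ℕ}
    (h : ∀ n : ℤ, IntegrableOn (fun y => f (up n y)) (cell .both)) : IntegrableOn f (strip N) := by
  rw [strip_eq_biUnion, integrableOn_finset_iUnion]
  intro n _
  have h1 := h n
  rw [← up_preimage_cell n] at h1
  exact ((measurePreserving_up n).integrableOn_comp_preimage (measurableEmbedding_up n)).1 h1

lemma setIntegral_strip {f : ℝ × ℝ → ℝ} {N : ℕ} (h : IntegrableOn f (strip N)) :
    ∫ y in strip N, f y = ∑ n ∈ Finset.Ico (-(N : ℤ)) N, ∫ y in cell .both, f (up n y) := by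
  rw [strip_eq_biUnion] at h ⊢
  rw [integral_biUnion_finset _ (fun n _ => measurableSet_Ico.prod measurableSet_Ico)]
  · refine Finset.sum_congr rfl fun n _ => ?_
    rw [← up_preimage_cell n]
    exact ((measurePreserving_up n).setIntegral_preimage_emb (measurableEmbedding_up n) _ _).symm
  · intro n _ k _ hnk
    refine Set.disjoint_left.2 fun y hy hy' => hnk ?_
    rw [← Int.floor_eq_iff.2 hy.2, ← Int.floor_eq_iff.2 hy'.2]
  · exact fun n hn => h.mono_set (subset_biUnion_of_mem (u := fun n : ℤ =>
      Ico (0 : ℝ) 1 ×ˢ Ico (n : ℝ) (n + 1)) hn)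

lemma perExt_fold_first (U : L2per .both) (y : ℝ × ℝ) :
    perExt .both U (fold .first y) = perExt .both U y := by
  obtain ⟨n, m, -, h⟩ := sub_fold_mem_lat .first y
  have hg : y - fold .first y ∈ lat .both := ⟨n, m, by simp, h⟩
  rw [← perExt_add_lat hg U (fold .first y), sub_add_cancel]

lemma integrableOn_strip_perExt (U : L2per .both) (N : ℕ) :
    IntegrableOn (fun y => ‖perExt .both U y‖ ^ 2) (strip N) := by
  refine integrableOn_strip fun n => ?_
  simp only [perExt_up]
  refine (integrable_norm_sq .both U).congr ?_
  filter_upwards [ae_restrict_mem (measurableSet_cell .both)] with y hy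
  rw [perExt_eq_on_cell U hy]

lemma setIntegral_strip_perExt (U : L2per .both) (N : ℕ) :
    ∫ y in strip N, ‖perExt .both U y‖ ^ 2 = 2 * N * ‖U‖ ^ 2 := by
  rw [setIntegral_strip (integrableOn_strip_perExt U N), norm_sq_L2per]
  simp only [perExt_up]
  have : ∫ y in cell .both, ‖perExt .both U y‖ ^ 2 = ∫ y in cell .both, ‖U y‖ ^ 2 :=
    setIntegral_congr_fun (measurableSet_cell .both) fun y hy => by
      simp only [perExt_eq_on_cell U hy]
  rw [this, Finset.sum_const, Int.card_Ico, nsmul_eq_mul]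
  congr 1
  have : ((N : ℤ) - -(N : ℤ)).toNat = 2 * N := by omega
  rw [this]
  push_cast
  ring

/-- The functions that vanish outside of `-N ≤ y₂ < N`. -/
def VanishesOff (N : ℕ) (χ : ℝ × ℝ → ℂ) : Prop := ∀ y, y.2 ∉ Ico (-(N : ℝ)) N → χ y = 0

lemma VanishesOff.of_mem_cell {N : ℕ} {χ : ℝ × ℝ → ℂ} (h : VanishesOff N χ) {y : ℝ × ℝ}
    (hy : y ∈ cell .first \ strip N) : χ y = 0 :=
  h y fun h' => hy.2 ⟨hy.1.1, h'⟩

lemma aestronglyMeasurable_perExt (p : Periodicity) (U : L2per p) :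
    AEStronglyMeasurable (perExt p U) volume := (locallyIntegrable_perExt p U).aestronglyMeasurable

lemma memLp_cut {χ : ℝ × ℝ →ᵇ ℂ} {N : ℕ} (hχ : VanishesOff N χ) (U : L2per .both) :
    MemLp (fun y => χ y * perExt .both U y) 2 (volume.restrict (cell .first)) := by
  have hm : AEStronglyMeasurable (fun y => χ y * perExt .both U y) volume :=
    χ.continuous.aestronglyMeasurable.mul (aestronglyMeasurable_perExt .both U)
  rw [memLp_two_iff_integrable_sq_norm hm.restrict]
  refine IntegrableOn.of_forall_sdiff_eq_zero (s := strip N) ?_ (measurableSet_cell .first)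
    fun y hy => by simp [hχ.of_mem_cell hy]
  refine ((integrableOn_strip_perExt U N).const_mul (‖χ‖ ^ 2)).mono' (hm.norm.pow 2).restrict
    (Eventually.of_forall fun y => ?_)
  rw [norm_mul, mul_pow, Real.norm_of_nonneg (by positivity)]
  gcongr
  exact χ.norm_coe_le_norm y

open Classical in
/-- The function `χ U` on the cylinder, for a doubly periodic `U`. -/
def cut (χ : ℝ × ℝ →ᵇ ℂ) (U : L2per .both) : L2per .first :=
  if h : MemLp (fun y => χ y * perExt .both U y) 2 (volume.restrict (cell .first)) then h.toLp
  else 0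

lemma coeFn_cut {χ : ℝ × ℝ →ᵇ ℂ} {N : ℕ} (hχ : VanishesOff N χ) (U : L2per .both) :
    cut χ U =ᵐ[volume.restrict (cell .first)] fun y => χ y * perExt .both U y := by
  rw [cut, dif_pos (memLp_cut hχ U)]
  exact MemLp.coeFn_toLp _

lemma perExt_cut {χ : ℝ × ℝ →ᵇ ℂ} {N : ℕ} (hχ : VanishesOff N χ) (hp : IsPer .first χ)
    (U : L2per .both) : perExt .first (cut χ U) =ᵐ[volume] fun y => χ y * perExt .both U y := by
  filter_upwards [(quasiMeasurePreserving_fold .first).ae (coeFn_cut hχ U)] with y h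
  rw [perExt, h, hp, perExt_fold_first]

lemma cut_add {χ : ℝ × ℝ →ᵇ ℂ} {N : ℕ} (hχ : VanishesOff N χ) (U V : L2per .both) :
    cut χ (U + V) = cut χ U + cut χ V := by
  refine Lp.ext ?_
  filter_upwards [coeFn_cut hχ (U + V), coeFn_cut hχ U, coeFn_cut hχ V,
    Lp.coeFn_add (cut χ U) (cut χ V), ae_restrict_of_ae (perExt_add .both U V)]
    with y h1 h2 h3 h4 h5
  rw [h1, h4, Pi.add_apply, h2, h3, h5, mul_add]

lemma cut_smul {χ : ℝ × ℝ →ᵇ ℂ} {N : ℕ} (hχ : VanishesOff N χ) (c : ℂ) (U : L2per .both) :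
    cut χ (c • U) = c • cut χ U := by
  refine Lp.ext ?_
  filter_upwards [coeFn_cut hχ (c • U), coeFn_cut hχ U, Lp.coeFn_smul c (cut χ U),
    ae_restrict_of_ae (perExt_smul .both c U)] with y h1 h2 h3 h4
  rw [h1, h3, Pi.smul_apply, h2, h4, smul_eq_mul]
  ring

lemma cut_mulL {χ m : ℝ × ℝ →ᵇ ℂ} {N : ℕ} (hχ : VanishesOff N χ) (hm : IsPer .both m)
    (U : L2per .both) : cut χ (mulL .both m U) = mulL .first m (cut χ U) := by
  refine Lp.ext ?_
  filter_upwards [coeFn_cut hχ (mulL .both m U), coeFn_cut hχ U, coeFn_mulL .first m (cut χ U),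
    ae_restrict_of_ae (perExt_mulL hm U)] with y h1 h2 h3 h4
  rw [h1, h3, h2, h4]
  ring

/-- The Leibniz rule for periodic extensions: the error term χ'U is the only defect when a doubly
periodic solution is carried to the cylinder. -/
lemma hasD_cut {χ χ' : ℝ × ℝ →ᵇ ℂ} {N : ℕ} {θ : ℝ × ℝ} (hχ : VanishesOff N χ)
    (hχ' : VanishesOff N χ') (hp : IsPer .first χ) (hp' : IsPer .first χ') (hd : ContDiff ℝ ∞ χ)
    (hdd : ∀ y, χ' y = dirD θ χ y) {U W : L2per .both} (h : HasD .both θ U W) :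
    HasD .first θ (cut χ U) (cut χ W + cut χ' U) := by
  refine (HasWeakDirDeriv.mul h (locallyIntegrable_perExt _ U) (locallyIntegrable_perExt _ W)
    hd).congr (perExt_cut hχ hp U) ?_
  filter_upwards [perExt_add .first (cut χ W) (cut χ' U), perExt_cut hχ hp W,
    perExt_cut hχ' hp' U] with y h1 h2 h3
  rw [h1, h2, h3, hdd]

lemma norm_sq_cut {χ : ℝ × ℝ →ᵇ ℂ} {N : ℕ} (hχ : VanishesOff N χ) (U : L2per .both) :
    ‖cut χ U‖ ^ 2 = ∫ y in strip N, ‖χ y‖ ^ 2 * ‖perExt .both U y‖ ^ 2 := by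
  rw [norm_sq_L2per, ← setIntegral_eq_of_subset_of_forall_sdiff_eq_zero (measurableSet_cell .first)
    (strip_subset_cell N) (fun y hy => by simp [hχ.of_mem_cell hy])]
  refine integral_congr_ae ?_
  filter_upwards [coeFn_cut hχ U] with y h
  rw [h, norm_mul, mul_pow]

lemma integrableOn_norm_sq_cut {χ : ℝ × ℝ →ᵇ ℂ} {N : ℕ} (U : L2per .both) :
    IntegrableOn (fun y => ‖χ y‖ ^ 2 * ‖perExt .both U y‖ ^ 2) (strip N) :=
  (integrableOn_strip_perExt U N).bdd_mul (c := ‖χ‖ ^ 2)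
    (χ.continuous.norm.pow 2).aestronglyMeasurable (Eventually.of_forall fun y => by
      rw [Real.norm_of_nonneg (by positivity)]
      gcongr
      exact χ.norm_coe_le_norm y)

lemma norm_sq_cut_le {χ : ℝ × ℝ →ᵇ ℂ} {N : ℕ} (hχ : VanishesOff N χ) {C : ℝ}
    (hC : ∀ y, ‖χ y‖ ≤ C) (U : L2per .both) : ‖cut χ U‖ ^ 2 ≤ C ^ 2 * (2 * N * ‖U‖ ^ 2) := by
  rw [norm_sq_cut hχ, ← setIntegral_strip_perExt, ← integral_const_mul]
  refine integral_mono (integrableOn_norm_sq_cut U)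
    ((integrableOn_strip_perExt U N).const_mul _) fun y => ?_
  simp only
  gcongr
  exact hC y

/-- The region where χ = 1 contains 2M full unit cells. With `norm_sq_cut_le` this shows that
cutting multiplies squared norms by a factor comparable to the number of cells, so a cutoff
derivative of size 1/N is negligible. -/
lemma le_norm_sq_cut {χ : ℝ × ℝ →ᵇ ℂ} {N M : ℕ} (hχ : VanishesOff N χ) (hMN : M ≤ N)
    (h1 : ∀ y ∈ strip M, χ y = 1) (U : L2per .both) : 2 * M * ‖U‖ ^ 2 ≤ ‖cut χ U‖ ^ 2 := by
  have hsub : strip M ⊆ strip N := by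
    have : (M : ℝ) ≤ N := by exact_mod_cast hMN
    exact prod_mono_right (Ico_subset_Ico (by linarith) this)
  rw [norm_sq_cut hχ, ← setIntegral_strip_perExt]
  calc ∫ y in strip M, ‖perExt .both U y‖ ^ 2
      = ∫ y in strip M, ‖χ y‖ ^ 2 * ‖perExt .both U y‖ ^ 2 :=
        setIntegral_congr_fun (measurableSet_strip M) fun y hy => by simp [h1 y hy]
    _ ≤ _ := setIntegral_mono_set (integrableOn_norm_sq_cut U)
        (Eventually.of_forall fun y => by positivity) (Eventually.of_forall hsub)

/-- Smooth cutoffs in the second variable. -/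
lemma exists_cutoff (θ : ℝ × ℝ) : ∃ K : ℝ, 0 ≤ K ∧ ∀ N : ℕ, 0 < N → ∃ χ χ' : ℝ × ℝ →ᵇ ℂ,
    IsPer .first χ ∧ IsPer .first χ' ∧ ContDiff ℝ ∞ χ ∧ (∀ y, χ' y = dirD θ χ y) ∧
    (∀ y, ‖χ y‖ ≤ 1) ∧ (∀ y, ‖χ' y‖ ≤ K / N) ∧ (∀ y ∈ strip N, χ y = 1) ∧
    VanishesOff (2 * N) χ ∧ VanishesOff (2 * N) χ' := by
  -- The bump is 1 on [-1,1] and 0 outside (-2,2). Evaluated at y₂/N it is 1 on `strip N`, and D_θ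
  -- brings out a factor θ₂/N.
  let ψ : ContDiffBump (0 : ℝ) := ⟨1, 2, by norm_num, by norm_num⟩
  have hψ : ContDiff ℝ ∞ ψ := ψ.contDiff
  have hψ' : Continuous (deriv ψ) := hψ.continuous_deriv (by simp)
  obtain ⟨B, hB⟩ := ψ.hasCompactSupport.deriv.exists_bound_of_continuous hψ'
  have hB0 : 0 ≤ B := (norm_nonneg _).trans (hB 0)
  refine ⟨B * |θ.2|, by positivity, fun N hN => ?_⟩
  have hN' : (0 : ℝ) < N := by exact_mod_cast hN
  have hsm : ContDiff ℝ ∞ fun y : ℝ × ℝ => (ψ (y.2 / N) : ℂ) :=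
    Complex.ofRealCLM.contDiff.comp (hψ.comp (contDiff_snd.div_const _))
  have hdir : ∀ y, dirD θ (fun y : ℝ × ℝ => (ψ (y.2 / N) : ℂ)) y =
      ((deriv ψ (y.2 / N) * (θ.2 / N) : ℝ) : ℂ) := by
    intro y
    have h1 : HasFDerivAt (fun y : ℝ × ℝ => y.2 / N)
        ((N : ℝ)⁻¹ • ContinuousLinearMap.snd ℝ ℝ ℝ) y := by
      simp only [div_eq_mul_inv]
      exact hasFDerivAt_snd.mul_const _
    have h2 := Complex.ofRealCLM.hasFDerivAt.comp y
      (((hψ.differentiable (by simp)) (y.2 / N)).hasDerivAt.comp_hasFDerivAt y h1)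
    refine (DFunLike.congr_fun h2.fderiv θ).trans ?_
    simp
    left
    ring
  have hz : ∀ t : ℝ, t ∉ Ioo (-2 : ℝ) 2 → ψ t = 0 := fun t ht => by
    refine ψ.zero_of_le_dist ?_
    rw [Real.dist_eq, sub_zero, le_abs]
    by_contra h
    push Not at h
    exact ht ⟨by linarith [h.2], h.1⟩
  -- The endpoint t = 2 lies outside the half-open interval, so the derivative must vanish there
  -- too; ψ is constant on the adjacent half-line and the one-sided derivative is unique.
  have hz' : ∀ t : ℝ, t ∉ Ico (-2 : ℝ) 2 → deriv ψ t = 0 := fun t ht => by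
    have hd := (hψ.differentiable (by simp) t).hasDerivAt
    have ht' : 2 ≤ t ∨ t ≤ -2 := by
      by_contra h
      push Not at h
      exact ht ⟨h.2.le, h.1⟩
    rcases ht' with h | h
    · have hu := uniqueDiffOn_Ici (2 : ℝ) t h
      have h0 : HasDerivWithinAt ψ 0 (Ici 2) t :=
        (hasDerivWithinAt_const t _ (0 : ℝ)).congr
          (fun s hs => hz s fun h => absurd h.2 (not_lt.2 hs))
          (hz t fun h' => absurd h'.2 (not_lt.2 h))
      exact hu.eq_deriv _ hd.hasDerivWithinAt h0
    · have hu := uniqueDiffOn_Iic (-2 : ℝ) t h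
      have h0 : HasDerivWithinAt ψ 0 (Iic (-2)) t :=
        (hasDerivWithinAt_const t _ (0 : ℝ)).congr
          (fun s hs => hz s fun h => absurd h.1 (not_lt.2 hs))
          (hz t fun h' => absurd h'.1 (not_lt.2 h))
      exact hu.eq_deriv _ hd.hasDerivWithinAt h0
  have hscale : ∀ y : ℝ × ℝ, y.2 ∉ Ico (-((2 * N : ℕ) : ℝ)) (2 * N : ℕ) →
      y.2 / N ∉ Ico (-2 : ℝ) 2 := fun y hy h => by
    rw [mem_Ico, le_div_iff₀ hN', div_lt_iff₀ hN'] at h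
    exact hy (by push_cast; exact ⟨by linarith [h.1], h.2⟩)
  refine ⟨BoundedContinuousFunction.ofNormedAddCommGroup _ hsm.continuous 1 fun y => ?_,
    BoundedContinuousFunction.ofNormedAddCommGroup
      (fun y => ((deriv ψ (y.2 / N) * (θ.2 / N) : ℝ) : ℂ)) (by fun_prop)
      (B * |θ.2| / N) fun y => ?_,
    ?_, ?_, hsm, fun y => (hdir y).symm, fun y => ?_, fun y => ?_, fun y hy => ?_, fun y hy => ?_,
    fun y hy => ?_⟩
  · rw [Complex.norm_real, Real.norm_of_nonneg ψ.nonneg]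
    exact ψ.le_one
  · rw [Complex.norm_real, norm_mul, Real.norm_eq_abs (θ.2 / N), abs_div, Nat.abs_cast,
      mul_div_assoc]
    gcongr
    exact hB _
  · intro y; simp [fold, shift]
  · intro y; simp [fold, shift]
  · change ‖(ψ (y.2 / N) : ℂ)‖ ≤ 1
    rw [Complex.norm_real, Real.norm_of_nonneg ψ.nonneg]
    exact ψ.le_one
  · change ‖((deriv ψ (y.2 / N) * (θ.2 / N) : ℝ) : ℂ)‖ ≤ B * |θ.2| / N
    rw [Complex.norm_real, norm_mul, Real.norm_eq_abs (θ.2 / N), abs_div, Nat.abs_cast,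
      mul_div_assoc]
    gcongr
    exact hB _
  · change (ψ (y.2 / N) : ℂ) = 1
    have : ψ (y.2 / N) = 1 := ψ.one_of_mem_closedBall (by
      rw [Metric.mem_closedBall, Real.dist_eq, sub_zero, abs_div, Nat.abs_cast, div_le_one hN',
        abs_le]
      exact ⟨hy.2.1, hy.2.2.le⟩)
    rw [this, Complex.ofReal_one]
  · change (ψ (y.2 / N) : ℂ) = 0
    rw [hz _ fun h => hscale y hy (Ioo_subset_Ico_self h), Complex.ofReal_zero]
  · change ((deriv ψ (y.2 / N) * (θ.2 / N) : ℝ) : ℂ) = 0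
    rw [hz' _ (hscale y hy), zero_mul, Complex.ofReal_zero]

lemma norm_add_sq_le_two {E : Type*} [SeminormedAddCommGroup E] (a b : E) :
    ‖a + b‖ ^ 2 ≤ 2 * (‖a‖ ^ 2 + ‖b‖ ^ 2) := by
  have := norm_add_le a b
  nlinarith [sq_nonneg (‖a‖ - ‖b‖), norm_nonneg (a + b)]

/-- A lower bound on the cylinder implies one on the torus. -/
lemma SystemBound.both_of_first {θ : ℝ × ℝ} {m r : ℝ × ℝ →ᵇ ℂ} (hm : IsPer .both m)
    (hr : IsPer .both r) {z : ℂ} {c : ℝ} (hc : 0 < c)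
    (h : SystemBound (HasD .first θ) (mulL .first m) (mulL .first r) z 0 c) :
    SystemBound (HasD .both θ) (mulL .both m) (mulL .both r) z 0 (c / 8) := by
  intro U W P Q hUW hPQ
  obtain ⟨K, hK0, hK⟩ := exists_cutoff θ
  -- With n = N + 1 this gives 8 (K/n)² ≤ c, which lets half of the left side absorb the cutoff
  -- error.
  obtain ⟨N, hN⟩ := exists_nat_gt (8 * K ^ 2 / c)
  obtain ⟨χ, χ', p1, p2, hd, hdd, b1, b2, h1, v1, v2⟩ := hK (N + 1) N.succ_pos
  simp only [zero_smul, add_zero]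
  set F := W - mulL .both m P with hF
  set G := Q + z • mulL .both r U with hG
  have key := h _ _ _ _ (hasD_cut v1 v2 p1 p2 hd hdd hUW) (hasD_cut v1 v2 p1 p2 hd hdd hPQ)
  simp only [zero_smul, add_zero] at key
  have e1 : cut χ W + cut χ' U - mulL .first m (cut χ P) = cut χ F + cut χ' U := by
    have : W = F + mulL .both m P := by rw [hF, sub_add_cancel]
    rw [← cut_mulL v1 hm]
    conv_lhs => rw [this]
    rw [cut_add v1]
    abel
  have e2 : cut χ Q + cut χ' P + z • mulL .first r (cut χ U) = cut χ G + cut χ' P := by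
    rw [← cut_mulL v1 hr, ← cut_smul v1, hG, cut_add v1]
    abel
  rw [e1, e2] at key
  set n : ℝ := ((N + 1 : ℕ) : ℝ) with hn
  have hn0 : 0 < n := by positivity
  have f1 := norm_sq_cut_le v1 b1 F
  have f2 := norm_sq_cut_le v1 b1 G
  have f3 := norm_sq_cut_le v2 b2 U
  have f4 := norm_sq_cut_le v2 b2 P
  have l1 := le_norm_sq_cut v1 (by omega) h1 U
  have l2 := le_norm_sq_cut v1 (by omega) h1 P
  have a1 := norm_add_sq_le_two (cut χ F) (cut χ' U)
  have a2 := norm_add_sq_le_two (cut χ G) (cut χ' P)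
  have hcast : ((2 * (N + 1) : ℕ) : ℝ) = 2 * n := by push_cast [hn]; ring
  rw [hcast] at f1 f2 f3 f4
  rw [← hn] at l1 l2
  set X := ‖U‖ ^ 2 + ‖P‖ ^ 2 with hX
  set Y := ‖F‖ ^ 2 + ‖G‖ ^ 2 with hY
  have hX0 : 0 ≤ X := by positivity
  -- The cutoff is 1 on 2n cells and lives on 4n cells; splitting the norm of a sum costs another
  -- factor 2. After absorption this yields c X ≤ 8 Y, the origin of c / 8.
  have s1 : c * (2 * n * X) ≤ 8 * n * Y + 8 * n * ((K / n) ^ 2 * X) := by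
    have : c * (2 * n * X) ≤ c * (‖cut χ U‖ ^ 2 + ‖cut χ P‖ ^ 2) := by
      gcongr
      rw [hX]
      linarith
    have f5 : ‖cut χ' U‖ ^ 2 + ‖cut χ' P‖ ^ 2 ≤ 4 * n * ((K / n) ^ 2 * X) := by
      calc _ ≤ _ := add_le_add f3 f4
        _ = _ := by rw [hX]; ring
    have f6 : ‖cut χ F‖ ^ 2 + ‖cut χ G‖ ^ 2 ≤ 4 * n * Y := by
      calc _ ≤ _ := add_le_add f1 f2
        _ = _ := by rw [hY]; ring
    linarith
  have s2 : 8 * (K / n) ^ 2 ≤ c := by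
    have hn1 : 1 ≤ n := by rw [hn]; push_cast; linarith [N.cast_nonneg (α := ℝ)]
    have hNn : (N : ℝ) ≤ n := by rw [hn]; push_cast; linarith
    rw [div_lt_iff₀ hc] at hN
    rw [div_pow, mul_div_assoc', div_le_iff₀ (by positivity)]
    calc 8 * K ^ 2 ≤ n * c := hN.le.trans (by gcongr)
      _ = c * (n * 1) := by ring
      _ ≤ c * (n * n) := by gcongr
      _ = c * n ^ 2 := by ring
  have s3 : 2 * n * (c * X) ≤ 2 * n * (4 * Y + c / 2 * X) := by
    have : 8 * n * ((K / n) ^ 2 * X) ≤ n * (c * X) := by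
      calc 8 * n * ((K / n) ^ 2 * X) = n * (8 * (K / n) ^ 2 * X) := by ring
        _ ≤ n * (c * X) := by gcongr
    linarith
  have s4 := le_of_mul_le_mul_left s3 (by positivity)
  linarith

/-! ### Folding functions of bounded support onto the torus -/

lemma HasWeakDirDeriv.up {θ : ℝ × ℝ} {u w : ℝ × ℝ → ℂ} (h : HasWeakDirDeriv θ u w) (n : ℤ) :
    HasWeakDirDeriv θ (fun y => u (up n y)) (fun y => w (up n y)) := by
  intro φ h1 h2
  have hφ : IsTest φ := ⟨h1, h2⟩
  have hψ := hφ.translate (-(0, (n : ℝ)))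
  have e := h _ hψ.1 hψ.2
  rw [← integral_add_right_eq_self _ ((0 : ℝ), (n : ℝ)),
    ← integral_add_right_eq_self (fun y => w y * φ (-(0, (n : ℝ)) + y)) ((0 : ℝ), (n : ℝ))] at e
  have e1 : ∀ y : ℝ × ℝ, fderiv ℝ (fun y => φ (-(0, (n : ℝ)) + y)) (y + (0, (n : ℝ))) θ =
      fderiv ℝ φ y θ := fun y => by
    have := dirD_translate hφ θ (-(0, (n : ℝ))) (y + (0, (n : ℝ)))
    rw [neg_add_cancel_comm_assoc] at this
    exact this
  simp only [e1, neg_add_cancel_comm_assoc] at e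
  exact e

lemma locallyIntegrable_up {u : ℝ × ℝ → ℂ} (hu : LocallyIntegrable u volume) (n : ℤ) :
    LocallyIntegrable (fun y => u (up n y)) volume := by
  have h := (locallyIntegrable_map_homeomorph (μ := volume)
    (Homeomorph.addRight ((0 : ℝ), (n : ℝ))) (f := u)).1
  refine h ?_
  have : Measure.map (Homeomorph.addRight ((0 : ℝ), (n : ℝ))) volume =
      (volume : Measure (ℝ × ℝ)) := (measurePreserving_up n).map_eq
  rwa [this]

lemma HasWeakDirDeriv.sum {ι : Type*} (S : Finset ι) {θ : ℝ × ℝ} {u w : ι → ℝ × ℝ → ℂ}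
    (h : ∀ i, HasWeakDirDeriv θ (u i) (w i)) (hu : ∀ i, LocallyIntegrable (u i) volume)
    (hw : ∀ i, LocallyIntegrable (w i) volume) :
    HasWeakDirDeriv θ (fun y => ∑ i ∈ S, u i y) (fun y => ∑ i ∈ S, w i y) := by
  intro φ h1 h2
  have hi : ∀ (v g : ℝ × ℝ → ℂ), LocallyIntegrable v volume → IsTest g →
      Integrable (fun y => v y * g y) volume := fun v g hv hg =>
    (hv.integrable_smul_left_of_hasCompactSupport hg.1.continuous hg.2).congr
      (Eventually.of_forall fun y => by simp [mul_comm])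
  simp only [Finset.sum_mul]
  change ∫ y, ∑ i ∈ S, u i y * dirD θ φ y = _
  rw [integral_finsetSum _ fun i _ => hi _ _ (hu i) (IsTest.dirD ⟨h1, h2⟩ θ),
    integral_finsetSum _ fun i _ => hi _ _ (hw i) ⟨h1, h2⟩, ← Finset.sum_neg_distrib]
  exact Finset.sum_congr rfl fun i _ => h i φ h1 h2

lemma up_mem_cell_first {y : ℝ × ℝ} (hy : y ∈ cell .both) (n : ℤ) : up n y ∈ cell .first :=
  ⟨by simpa [up] using hy.1, mem_univ _⟩

lemma memLp_perExt_up (U : L2per .first) (n : ℤ) :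
    MemLp (fun y => perExt .first U (up n y)) 2 (volume.restrict (cell .both)) := by
  have h1 : MemLp U 2 ((volume : Measure (ℝ × ℝ)).restrict (Ico 0 1 ×ˢ Ico (n : ℝ) (n + 1))) :=
    (Lp.memLp U).mono_measure (Measure.restrict_mono (prod_mono_right (subset_univ _)) le_rfl)
  have h2 := h1.comp_measurePreserving ((measurePreserving_up n).restrict_preimage
    (measurableSet_Ico.prod measurableSet_Ico))
  rw [up_preimage_cell] at h2
  refine (memLp_congr_ae ?_).1 h2
  filter_upwards [ae_restrict_mem (measurableSet_cell .both)] with y hy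
  exact (perExt_eq_on_cell U (up_mem_cell_first hy n)).symm

lemma memLp_foldSum (N : ℕ) (U : L2per .first) :
    MemLp (fun y => ∑ n ∈ Finset.Ico (-(N : ℤ)) N, perExt .first U (up n y)) 2
      (volume.restrict (cell .both)) :=
  memLp_finsetSum _ fun n _ => memLp_perExt_up U n

/-- The periodization in the second variable of the part of `U` in `-N ≤ y₂ < N`. -/
def foldSum (N : ℕ) (U : L2per .first) : L2per .both := (memLp_foldSum N U).toLp

lemma coeFn_foldSum (N : ℕ) (U : L2per .first) :
    foldSum N U =ᵐ[volume.restrict (cell .both)]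
      fun y => ∑ n ∈ Finset.Ico (-(N : ℤ)) N, perExt .first U (up n y) :=
  (memLp_foldSum N U).coeFn_toLp

lemma ae_up {P : ℝ × ℝ → Prop} (h : ∀ᵐ y, P y) : ∀ᵐ y : ℝ × ℝ, ∀ n : ℤ, P (up n y) :=
  ae_all_iff.2 fun n => (measurePreserving_up n).quasiMeasurePreserving.ae h

lemma foldSum_add (N : ℕ) (U V : L2per .first) :
    foldSum N (U + V) = foldSum N U + foldSum N V := by
  refine Lp.ext ?_
  filter_upwards [coeFn_foldSum N (U + V), coeFn_foldSum N U, coeFn_foldSum N V,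
    Lp.coeFn_add (foldSum N U) (foldSum N V), ae_restrict_of_ae (ae_up (perExt_add .first U V))]
    with y h1 h2 h3 h4 h5
  rw [h1, h4, Pi.add_apply, h2, h3, ← Finset.sum_add_distrib]
  exact Finset.sum_congr rfl fun n _ => h5 n

lemma foldSum_smul (N : ℕ) (c : ℂ) (U : L2per .first) :
    foldSum N (c • U) = c • foldSum N U := by
  refine Lp.ext ?_
  filter_upwards [coeFn_foldSum N (c • U), coeFn_foldSum N U,
    Lp.coeFn_smul c (foldSum N U), ae_restrict_of_ae (ae_up (perExt_smul .first c U))]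
    with y h1 h2 h3 h4
  rw [h1, h3, Pi.smul_apply, h2, smul_eq_mul, Finset.mul_sum]
  exact Finset.sum_congr rfl fun n _ => h4 n

lemma IsPer.up {m : ℝ × ℝ → ℂ} (hm : IsPer .both m) (n : ℤ) (y : ℝ × ℝ) : m (up n y) = m y := by
  obtain ⟨g, hg, h⟩ := up_eq_add_lat n y
  rw [h, ← hm, fold_add_lat hg, hm]

lemma IsPer.first {m : ℝ × ℝ → ℂ} (hm : IsPer .both m) : IsPer .first m := by
  intro y
  obtain ⟨n, k, -, h⟩ := sub_fold_mem_lat .first y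
  have hg : y - fold .first y ∈ lat .both := ⟨n, k, by simp, h⟩
  have := fold_add_lat hg (fold .first y)
  rw [sub_add_cancel] at this
  rw [← hm y, this, hm]

lemma foldSum_mulL (N : ℕ) {m : ℝ × ℝ →ᵇ ℂ} (hm : IsPer .both m) (U : L2per .first) :
    foldSum N (mulL .first m U) = mulL .both m (foldSum N U) := by
  refine Lp.ext ?_
  filter_upwards [coeFn_foldSum N (mulL .first m U), coeFn_foldSum N U,
    coeFn_mulL .both m (foldSum N U), ae_restrict_of_ae (ae_up (perExt_mulL hm.first U))]
    with y h1 h2 h3 h4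
  rw [h1, h3, h2, Finset.mul_sum]
  exact Finset.sum_congr rfl fun n _ => by rw [h4 n, hm.up]

/-- `U` vanishes outside of `-N ≤ y₂ < N`. -/
def SuppIn (N : ℕ) (U : L2per .first) : Prop :=
  ∀ᵐ y : ℝ × ℝ, y.2 ∉ Ico (-(N : ℝ)) N → perExt .first U y = 0

lemma SuppIn.add {N : ℕ} {U V : L2per .first} (h : SuppIn N U) (h' : SuppIn N V) :
    SuppIn N (U + V) := by
  filter_upwards [h, h', perExt_add .first U V] with y h1 h2 h3 hy
  rw [h3, h1 hy, h2 hy, add_zero]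

lemma SuppIn.smul {N : ℕ} {U : L2per .first} (c : ℂ) (h : SuppIn N U) : SuppIn N (c • U) := by
  filter_upwards [h, perExt_smul .first c U] with y h1 h2 hy
  rw [h2, h1 hy, mul_zero]

lemma SuppIn.mulL {N : ℕ} {U : L2per .first} {m : ℝ × ℝ →ᵇ ℂ} (hm : IsPer .first m)
    (h : SuppIn N U) : SuppIn N (mulL .first m U) := by
  filter_upwards [h, perExt_mulL hm U] with y h1 h2 hy
  rw [h2, h1 hy, mul_zero]

lemma suppIn_mulL {N : ℕ} {χ : ℝ × ℝ →ᵇ ℂ} (hp : IsPer .first χ) (hχ : VanishesOff N χ)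
    (U : L2per .first) : SuppIn N (mulL .first χ U) := by
  filter_upwards [perExt_mulL hp U] with y h hy
  rw [h, hχ y hy, zero_mul]

/-- The integer part of y₁ is a period of U and drops out; that of y₂ is not, and shifts the index
of the vertical translate. -/
lemma perExt_up_fold (U : L2per .first) (n : ℤ) (y : ℝ × ℝ) :
    perExt .first U (up n (fold .both y)) = perExt .first U (up (n - ⌊y.2⌋) y) := by
  have hg : ((⌊y.1⌋ : ℝ), (0 : ℝ)) ∈ lat .first := ⟨⌊y.1⌋, 0, fun _ => rfl, by simp⟩
  rw [← perExt_add_lat hg U (up n (fold .both y))]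
  congr 1
  ext
  · simp [up, fold, shift]
  · simp only [up, fold, shift, Prod.snd_add, Prod.snd_sub, Int.cast_sub]
    ring

/-- The index range defining `foldSum` moves with ⌊y₂⌋. Because U is supported in -N ≤ y₂ < N, all
added translates vanish, so on a ball of radius r one fixed range serves for all y. -/
lemma perExt_foldSum {N M : ℕ} {r : ℝ} (hM : N + r + 1 ≤ M) {U : L2per .first}
    (hU : SuppIn N U) : ∀ᵐ y : ℝ × ℝ, ‖y‖ ≤ r → perExt .both (foldSum N U) y =
      ∑ n ∈ Finset.Ico (-(M : ℤ)) M, perExt .first U (up n y) := by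
  filter_upwards [(quasiMeasurePreserving_fold .both).ae (coeFn_foldSum N U), ae_up hU]
    with y h1 h2 hy
  have hy2 : |y.2| ≤ r := (norm_snd_le y).trans hy
  rw [abs_le] at hy2
  rw [perExt, h1]
  simp only [perExt_up_fold]
  set k := ⌊y.2⌋ with hk
  have hk1 : (k : ℝ) ≤ y.2 := Int.floor_le _
  have hk2 : y.2 < k + 1 := Int.lt_floor_add_one _
  have hsum : ∑ n ∈ Finset.Ico (-(N : ℤ)) N, perExt .first U (up (n - k) y) =
      ∑ n ∈ Finset.Ico (-(N : ℤ) - k) (N - k), perExt .first U (up n y) := by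
    refine Finset.sum_bij (fun n _ => n - k) ?_ ?_ ?_ ?_
    · intro n hn
      rw [Finset.mem_Ico] at hn ⊢
      omega
    · intro a _ b _ hab
      simpa using hab
    · intro b hb
      rw [Finset.mem_Ico] at hb
      exact ⟨b + k, by rw [Finset.mem_Ico]; omega, by simp⟩
    · intro n _
      rfl
  rw [hsum]
  refine Finset.sum_subset ?_ ?_
  · refine Finset.Ico_subset_Ico ?_ ?_
    · have : (k : ℝ) ≤ M - N := by linarith
      have : k ≤ (M : ℤ) - N := by exact_mod_cast this
      omega
    · have : (N : ℝ) - M ≤ k := by linarith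
      have : (N : ℤ) - M ≤ k := by exact_mod_cast this
      omega
  · intro n _ hn
    refine h2 n fun h => hn ?_
    simp only [up, Prod.snd_add, mem_Ico] at h
    rw [Finset.mem_Ico]
    constructor
    · have : (-(N : ℝ)) < k + n + 1 := by linarith
      have : (-(N : ℤ)) < k + n + 1 := by exact_mod_cast this
      omega
    · have : (k : ℝ) + n < N := by linarith
      have : k + n < (N : ℤ) := by exact_mod_cast this
      omega

/-- The support conditions prevent jumps at the edges of the strip: on the support of a given test
function the folded function is a fixed finite sum of translates, each with its own weak derivative.
-/
lemma hasD_foldSum {N : ℕ} {θ : ℝ × ℝ} {U W : L2per .first} (hU : SuppIn N U) (hW : SuppIn N W)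
    (h : HasD .first θ U W) : HasD .both θ (foldSum N U) (foldSum N W) := by
  intro φ h1 h2
  obtain ⟨r, hr⟩ := h2.isCompact.isBounded.subset_closedBall (0 : ℝ × ℝ)
  obtain ⟨M, hM⟩ := exists_nat_ge (N + r + 1)
  have key : ∀ (V : L2per .first) (g : ℝ × ℝ → ℂ), SuppIn N V → tsupport g ⊆ tsupport φ →
      ∫ y, perExt .both (foldSum N V) y * g y =
        ∫ y, (∑ n ∈ Finset.Ico (-(M : ℤ)) M, perExt .first V (up n y)) * g y := by
    intro V g hV hg
    refine integral_congr_ae ?_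
    filter_upwards [perExt_foldSum hM hV] with y hy
    by_cases hgy : g y = 0
    · simp [hgy]
    · rw [hy (by simpa using hr (hg (subset_tsupport g hgy)))]
  rw [key U _ hU (tsupport_fderiv_apply_subset ℝ θ), key W φ hW subset_rfl]
  exact HasWeakDirDeriv.sum (Finset.Ico (-(M : ℤ)) M) (u := fun n y => perExt .first U (up n y))
    (w := fun n y => perExt .first W (up n y)) (fun n => HasWeakDirDeriv.up h n)
    (fun n => locallyIntegrable_up (locallyIntegrable_perExt _ U) n)
    (fun n => locallyIntegrable_up (locallyIntegrable_perExt _ W) n) φ h1 h2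

/-! ### Discrete Bloch transform -/

/-- Orthogonality of the characters of a finite cyclic group. -/
lemma sum_exp_eq_zero {M : ℕ} (hM : 0 < M) {d : ℤ} (hd : ¬ (M : ℤ) ∣ d) :
    ∑ j ∈ Finset.range M, Complex.exp (2 * Real.pi * Complex.I * (d / M)) ^ j = 0 := by
  have hM' : (M : ℂ) ≠ 0 := by exact_mod_cast hM.ne'
  set w := Complex.exp (2 * Real.pi * Complex.I * (d / M)) with hw
  have h1 : w ^ M = 1 := by
    rw [hw, ← Complex.exp_nat_mul, Complex.exp_eq_one_iff]
    exact ⟨d, by field_simp⟩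
  have h2 : w ≠ 1 := by
    rw [hw, Ne, Complex.exp_eq_one_iff]
    rintro ⟨k, hk⟩
    refine hd ⟨k, ?_⟩
    have h3 : (d : ℂ) / M = k := by
      have h4 : (2 * Real.pi * Complex.I : ℂ) ≠ 0 := Complex.two_pi_I_ne_zero
      refine mul_left_cancel₀ h4 ?_
      rw [hk]
      ring
    rw [div_eq_iff hM'] at h3
    have h5 : (d : ℂ) = ((M * k : ℤ) : ℂ) := by rw [h3]; push_cast; ring
    exact_mod_cast h5
  have h3 := geom_sum_mul w M
  rw [h1, sub_self] at h3
  exact (mul_eq_zero.1 h3).resolve_right (sub_ne_zero.2 h2)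

/-- The discrete Plancherel identity. -/
lemma sum_norm_sq_dft {N : ℕ} (hN : 0 < N) (a : ℤ → ℂ) :
    ∑ j ∈ Finset.range (2 * N), ‖∑ n ∈ Finset.Ico (-(N : ℤ)) N,
      Complex.exp (((-(2 * Real.pi * j / (2 * N : ℕ)) * n : ℝ) : ℂ) * Complex.I) * a n‖ ^ 2 =
      2 * N * ∑ n ∈ Finset.Ico (-(N : ℤ)) N, ‖a n‖ ^ 2 := by
  set S := Finset.Ico (-(N : ℤ)) N with hS
  have hM : 0 < 2 * N := by omega
  have hM' : ((2 * N : ℕ) : ℂ) ≠ 0 := by exact_mod_cast hM.ne'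
  set e : ℕ → ℤ → ℂ := fun j n =>
    Complex.exp (((-(2 * Real.pi * j / (2 * N : ℕ)) * n : ℝ) : ℂ) * Complex.I) with he
  have h1 : ∀ (j : ℕ) (n k : ℤ), e j n * starRingEnd ℂ (e j k) =
      Complex.exp (2 * Real.pi * Complex.I * (((k - n : ℤ) : ℂ) / (2 * N : ℕ))) ^ j := by
    intro j n k
    simp only [he]
    rw [← Complex.exp_conj, ← Complex.exp_add, ← Complex.exp_nat_mul]
    congr 1
    rw [map_mul, Complex.conj_I, Complex.conj_ofReal]
    push_cast
    ring
  have h2 : ∀ n ∈ S, ∀ k ∈ S, ∑ j ∈ Finset.range (2 * N), e j n * starRingEnd ℂ (e j k) =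
      if n = k then ((2 * N : ℕ) : ℂ) else 0 := by
    intro n hn k hk
    simp only [h1]
    split_ifs with hnk
    · simp [hnk]
    · refine sum_exp_eq_zero hM fun hdvd => hnk ?_
      rw [hS, Finset.mem_Ico] at hn hk
      -- Both indices lie in an interval of 2N integers, so their difference is divisible by 2N only
      -- if it is 0.
      have := Int.eq_zero_of_abs_lt_dvd hdvd (by rw [abs_lt]; push_cast; omega)
      omega
  have h3 : ∀ x : ℂ, ((‖x‖ ^ 2 : ℝ) : ℂ) = x * starRingEnd ℂ x := fun x => by
    rw [Complex.mul_conj, Complex.normSq_eq_norm_sq]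
  refine Complex.ofReal_injective ?_
  rw [Complex.ofReal_mul, Complex.ofReal_sum, Complex.ofReal_sum]
  simp only [h3]
  calc ∑ j ∈ Finset.range (2 * N), (∑ n ∈ S, e j n * a n) * starRingEnd ℂ (∑ n ∈ S, e j n * a n)
      = ∑ j ∈ Finset.range (2 * N), ∑ n ∈ S, ∑ k ∈ S,
          (e j n * starRingEnd ℂ (e j k)) * (a n * starRingEnd ℂ (a k)) := by
        refine Finset.sum_congr rfl fun j _ => ?_
        rw [map_sum, Finset.sum_mul_sum]
        refine Finset.sum_congr rfl fun n _ => Finset.sum_congr rfl fun k _ => ?_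
        rw [map_mul]
        ring
    _ = ∑ n ∈ S, ∑ k ∈ S, (∑ j ∈ Finset.range (2 * N), e j n * starRingEnd ℂ (e j k)) *
          (a n * starRingEnd ℂ (a k)) := by
        rw [Finset.sum_comm]
        refine Finset.sum_congr rfl fun n _ => ?_
        rw [Finset.sum_comm]
        refine Finset.sum_congr rfl fun k _ => ?_
        rw [Finset.sum_mul]
    _ = ∑ n ∈ S, ((2 * N : ℕ) : ℂ) * (a n * starRingEnd ℂ (a n)) := by
        refine Finset.sum_congr rfl fun n hn => ?_
        rw [Finset.sum_eq_single n]
        · rw [h2 n hn n hn, if_pos rfl]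
        · intro k hk hkn
          rw [h2 n hn k hk, if_neg (Ne.symm hkn), zero_mul]
        · exact fun h => absurd hn h
    _ = _ := by rw [← Finset.mul_sum]; push_cast; ring

/-- The quasi-momenta `2πj / (2N)`. -/
def momentum (N j : ℕ) : ℝ := 2 * Real.pi * j / (2 * N : ℕ)

lemma isPer_first_charB (b : ℝ) : IsPer .first (charB (0, b)) := by
  intro y
  simp [charB_apply, fold, shift]

/-- The discrete Bloch transform. -/
def bloch (N j : ℕ) (U : L2per .first) : L2per .both :=
  foldSum N (mulL .first (charB (0, -momentum N j)) U)

lemma bloch_add (N j : ℕ) (U V : L2per .first) : bloch N j (U + V) = bloch N j U + bloch N j V := by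
  rw [bloch, map_add, foldSum_add]; rfl

lemma bloch_smul (N j : ℕ) (c : ℂ) (U : L2per .first) : bloch N j (c • U) = c • bloch N j U := by
  rw [bloch, map_smul, foldSum_smul]; rfl

lemma bloch_mulL (N j : ℕ) {m : ℝ × ℝ →ᵇ ℂ} (hm : IsPer .both m) (U : L2per .first) :
    bloch N j (mulL .first m U) = mulL .both m (bloch N j U) := by
  rw [bloch, mulL_comm, foldSum_mulL N hm]; rfl

/-- The factor exp(-iξy₂) contributes -iξθ₂ to the derivative. Hence D_θ + iξθ₂ acting on the
component of U gives the component of D_θ U, which is the fiber operator at ξ. -/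
lemma hasD_bloch {N : ℕ} (j : ℕ) {θ : ℝ × ℝ} {U W : L2per .first} (hU : SuppIn N U)
    (hW : SuppIn N W) (h : HasD .first θ U W) : HasD .both θ (bloch N j U)
      (bloch N j W - (((momentum N j * θ.2 : ℝ) : ℂ) * Complex.I) • bloch N j U) := by
  have hp := isPer_first_charB (-momentum N j)
  have h1 := h.charB hp
  have h2 := hasD_foldSum (hU.mulL hp) ((hW.add (hU.smul _)).mulL hp) h1
  have e : bloch N j W - (((momentum N j * θ.2 : ℝ) : ℂ) * Complex.I) • bloch N j U =
      bloch N j (W + ((((0, -momentum N j) : ℝ × ℝ).1 * θ.1 +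
        ((0, -momentum N j) : ℝ × ℝ).2 * θ.2 : ℝ) * Complex.I : ℂ) • U) := by
    rw [bloch_add, bloch_smul, sub_eq_add_neg, ← neg_smul]
    congr 2
    push_cast
    ring
  rw [e]
  exact h2

lemma norm_sq_of_suppIn {N : ℕ} {U : L2per .first} (hU : SuppIn N U) :
    ‖U‖ ^ 2 = ∫ y in strip N, ‖perExt .first U y‖ ^ 2 := by
  have h1 : ‖U‖ ^ 2 = ∫ y in cell .first, ‖perExt .first U y‖ ^ 2 := by
    rw [norm_sq_L2per]
    exact setIntegral_congr_fun (measurableSet_cell .first) fun y hy => by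
      simp only [perExt_eq_on_cell U hy]
  rw [h1, ← setIntegral_eq_of_subset_of_ae_sdiff_eq_zero
    (measurableSet_cell .first).nullMeasurableSet (strip_subset_cell N)]
  filter_upwards [hU] with y hy hys
  rw [hy fun h => hys.2 ⟨hys.1.1, h⟩]
  simp

/-- At each point of the unit cell this is the discrete Plancherel identity for the 2N values of U
at its vertical translates; the number of momenta equals the number of cells in the strip, so the
identity is exact. The remaining phase in y₂ has modulus 1. -/
lemma sum_norm_sq_bloch {N : ℕ} (hN : 0 < N) {U : L2per .first} (hU : SuppIn N U) :
    ∑ j ∈ Finset.range (2 * N), ‖bloch N j U‖ ^ 2 = 2 * N * ‖U‖ ^ 2 := by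
  have hint : ∀ n : ℤ, IntegrableOn (fun y => ‖perExt .first U (up n y)‖ ^ 2) (cell .both) :=
    fun n => (memLp_perExt_up U n).integrable_norm_pow (by norm_num)
  rw [norm_sq_of_suppIn hU, setIntegral_strip (integrableOn_strip hint)]
  simp only [norm_sq_L2per]
  rw [← integral_finsetSum _ fun j _ => integrable_norm_sq .both _,
    ← integral_finsetSum _ fun n _ => hint n, ← integral_const_mul]
  refine integral_congr_ae ?_
  have h1 : ∀ᵐ y ∂(volume : Measure (ℝ × ℝ)).restrict (cell .both), ∀ j : ℕ,
      bloch N j U y = ∑ n ∈ Finset.Ico (-(N : ℤ)) N,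
        charB (0, -momentum N j) (up n y) * perExt .first U (up n y) := by
    refine ae_all_iff.2 fun j => ?_
    filter_upwards [coeFn_foldSum N (mulL .first (charB (0, -momentum N j)) U),
      ae_restrict_of_ae (ae_up (perExt_mulL (isPer_first_charB (-momentum N j)) U))] with y e1 e2
    rw [bloch, e1]
    exact Finset.sum_congr rfl fun n _ => e2 n
  filter_upwards [h1] with y hy
  rw [← sum_norm_sq_dft hN]
  refine Finset.sum_congr rfl fun j _ => ?_
  rw [hy j]
  have e : ∀ n : ℤ, charB (0, -momentum N j) (up n y) =
      Complex.exp (((-momentum N j * y.2 : ℝ) : ℂ) * Complex.I) *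
      Complex.exp (((-(2 * Real.pi * j / (2 * N : ℕ)) * n : ℝ) : ℂ) * Complex.I) := by
    intro n
    rw [charB_apply, ← Complex.exp_add]
    congr 1
    simp only [up, momentum, Prod.fst_add, Prod.snd_add]
    push_cast
    ring
  simp only [e, mul_assoc]
  rw [← Finset.mul_sum, norm_mul, Complex.norm_exp_ofReal_mul_I, one_mul]

/-! ### Passage from the torus to the cylinder -/

/-- Lower bounds on the torus give lower bounds for functions on the cylinder with bounded
support. -/
lemma SystemBound.of_suppIn {θ : ℝ × ℝ} {m r : ℝ × ℝ →ᵇ ℂ} (hm : IsPer .both m)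
    (hr : IsPer .both r) {z : ℂ} {c : ℝ}
    (h : ∀ t : ℝ, SystemBound (HasD .both θ) (mulL .both m) (mulL .both r) z (t * Complex.I) c)
    {N : ℕ} (hN : 0 < N) {U W P Q : L2per .first} (hU : SuppIn N U) (hW : SuppIn N W)
    (hP : SuppIn N P) (hQ : SuppIn N Q) (hUW : HasD .first θ U W) (hPQ : HasD .first θ P Q) :
    c * (‖U‖ ^ 2 + ‖P‖ ^ 2) ≤
      ‖W - mulL .first m P‖ ^ 2 + ‖Q + z • mulL .first r U‖ ^ 2 := by
  have hF : SuppIn N (W - mulL .first m P) := by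
    have := hW.add ((hP.mulL hm.first).smul (-1))
    rwa [neg_one_smul, ← sub_eq_add_neg] at this
  have hG : SuppIn N (Q + z • mulL .first r U) := hQ.add ((hU.mulL hr.first).smul z)
  have hj : ∀ j : ℕ, c * (‖bloch N j U‖ ^ 2 + ‖bloch N j P‖ ^ 2) ≤
      ‖bloch N j (W - mulL .first m P)‖ ^ 2 + ‖bloch N j (Q + z • mulL .first r U)‖ ^ 2 := by
    intro j
    -- The fiber bound at imaginary shift ξ_j θ₂. Its constant does not depend on j, so summing over
    -- j and dividing by 2N recovers the same c.
    have h1 := h (momentum N j * θ.2) _ _ _ _ (hasD_bloch j hU hW hUW) (hasD_bloch j hP hQ hPQ)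
    rw [sub_add_cancel, sub_add_cancel] at h1
    have e : bloch N j (W - mulL .first m P) = bloch N j W - mulL .both m (bloch N j P) := by
      rw [← bloch_mulL N j hm, sub_eq_add_neg, ← neg_one_smul ℂ, bloch_add, bloch_smul,
        neg_one_smul, ← sub_eq_add_neg]
    rw [e, bloch_add, bloch_smul, bloch_mulL N j hr]
    exact h1
  have hsum := Finset.sum_le_sum fun j (_ : j ∈ Finset.range (2 * N)) => hj j
  rw [← Finset.mul_sum, Finset.sum_add_distrib, Finset.sum_add_distrib, sum_norm_sq_bloch hN hU,
    sum_norm_sq_bloch hN hP, sum_norm_sq_bloch hN hF, sum_norm_sq_bloch hN hG, ← mul_add,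
    ← mul_add] at hsum
  have hN' : (0 : ℝ) < 2 * N := by positivity
  refine le_of_mul_le_mul_left ?_ hN'
  linarith

lemma tendsto_norm_sq_mulL {χ : ℕ → ℝ × ℝ →ᵇ ℂ} (hb : ∀ N y, ‖χ N y‖ ≤ 1)
    (h1 : ∀ N, ∀ y ∈ strip (N + 1), χ N y = 1) (U : L2per .first) :
    Tendsto (fun N => ‖mulL .first (χ N) U‖ ^ 2) atTop (𝓝 (‖U‖ ^ 2)) := by
  have e : ∀ N, ‖mulL .first (χ N) U‖ ^ 2 = ∫ y in cell .first, ‖χ N y‖ ^ 2 * ‖U y‖ ^ 2 := by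
    intro N
    rw [norm_sq_L2per]
    refine integral_congr_ae ?_
    filter_upwards [coeFn_mulL .first (χ N) U] with y hy
    rw [hy, norm_mul, mul_pow]
  simp only [e]
  rw [norm_sq_L2per]
  refine tendsto_integral_of_dominated_convergence (fun y => ‖U y‖ ^ 2) (fun N => ?_)
    (integrable_norm_sq .first U) (fun N => Eventually.of_forall fun y => ?_) ?_
  · exact (((χ N).continuous.norm.pow 2).aestronglyMeasurable).mul
      (integrable_norm_sq .first U).aestronglyMeasurable
  · rw [Real.norm_of_nonneg (by positivity)]
    refine mul_le_of_le_one_left (by positivity) (pow_le_one₀ (norm_nonneg _) (hb N y))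
  · filter_upwards [ae_restrict_mem (measurableSet_cell .first)] with y hy
    refine tendsto_const_nhds.congr' ?_
    obtain ⟨M, hM⟩ := exists_nat_gt |y.2|
    filter_upwards [eventually_ge_atTop M] with N hN
    have hMN : (M : ℝ) ≤ N := by exact_mod_cast hN
    have h2 := abs_lt.1 hM
    rw [h1 N y ⟨hy.1, by push_cast; linarith [h2.1], by push_cast; linarith [h2.2]⟩]
    simp

lemma norm_mulL_le {p : Periodicity} {m : ℝ × ℝ →ᵇ ℂ} {C : ℝ} (hC : ∀ y, ‖m y‖ ≤ C)
    (U : L2per p) : ‖mulL p m U‖ ≤ C * ‖U‖ := by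
  refine Lp.norm_le_mul_norm_of_ae_le_mul ?_
  filter_upwards [coeFn_mulL p m U] with y h
  rw [h, norm_mul]
  gcongr
  exact hC y

/-- Lower bounds on the torus imply lower bounds on the cylinder. -/
lemma SystemBound.first_of_both {θ : ℝ × ℝ} {m r : ℝ × ℝ →ᵇ ℂ} (hm : IsPer .both m)
    (hr : IsPer .both r) {z : ℂ} {c : ℝ}
    (h : ∀ t : ℝ, SystemBound (HasD .both θ) (mulL .both m) (mulL .both r) z (t * Complex.I) c) :
    SystemBound (HasD .first θ) (mulL .first m) (mulL .first r) z 0 c := by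
  intro U W P Q hUW hPQ
  obtain ⟨K, hK0, hK⟩ := exists_cutoff θ
  choose χ χ' p1 p2 hd hdd b1 b2 h1 v1 v2 using fun N : ℕ => hK (N + 1) N.succ_pos
  simp only [zero_smul, add_zero]
  set F := W - mulL .first m P with hF
  set G := Q + z • mulL .first r U with hG
  -- The cutoff has size at most 1 and derivative at most K/(N+1), so no constant is lost in the
  -- limit N → ∞.
  have key : ∀ N : ℕ, c * (‖mulL .first (χ N) U‖ ^ 2 + ‖mulL .first (χ N) P‖ ^ 2) ≤
      (‖F‖ + K / (N + 1 : ℕ) * ‖U‖) ^ 2 + (‖G‖ + K / (N + 1 : ℕ) * ‖P‖) ^ 2 := by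
    intro N
    have s := fun V => suppIn_mulL (p1 N) (v1 N) V
    have s' := fun V => suppIn_mulL (p2 N) (v2 N) V
    have h2 := SystemBound.of_suppIn hm hr h (by omega) (s U) ((s W).add (s' U)) (s P)
      ((s Q).add (s' P)) (hUW.mulL (p1 N) (p2 N) (hd N) (hdd N))
      (hPQ.mulL (p1 N) (p2 N) (hd N) (hdd N))
    have e1 : mulL .first (χ N) W + mulL .first (χ' N) U - mulL .first m (mulL .first (χ N) P) =
        mulL .first (χ N) F + mulL .first (χ' N) U := by
      rw [mulL_comm, hF, map_sub]
      abel
    have e2 : mulL .first (χ N) Q + mulL .first (χ' N) P +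
        z • mulL .first r (mulL .first (χ N) U) =
        mulL .first (χ N) G + mulL .first (χ' N) P := by
      rw [mulL_comm, hG, map_add, map_smul]
      abel
    rw [e1, e2] at h2
    have hle : ∀ A B : L2per .first, ‖mulL .first (χ N) A + mulL .first (χ' N) B‖ ≤
        ‖A‖ + K / (N + 1 : ℕ) * ‖B‖ := fun A B =>
      (norm_add_le _ _).trans (add_le_add (by simpa using norm_mulL_le (b1 N) A)
        (norm_mulL_le (b2 N) B))
    exact h2.trans (by gcongr <;> exact hle _ _)
  have hz : Tendsto (fun N : ℕ => K / (N + 1 : ℕ)) atTop (𝓝 0) :=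
    (tendsto_const_div_atTop_nhds_zero_nat K).comp (tendsto_add_atTop_nat 1)
  have hl := ((tendsto_norm_sq_mulL b1 h1 U).add (tendsto_norm_sq_mulL b1 h1 P)).const_mul c
  have hr' := (((hz.mul_const ‖U‖).const_add ‖F‖).pow 2).add
    (((hz.mul_const ‖P‖).const_add ‖G‖).pow 2)
  have := le_of_tendsto_of_tendsto' hl hr' key
  simpa using this

/-! ### Equality of the spectra -/

/-- The existence of a lower bound on the torus does not depend on the quasi-momentum and is
equivalent to a lower bound on the cylinder. -/
lemma exists_systemBound_iff {θ : ℝ × ℝ} (hθ : Irrational (θ.1 / θ.2)) {m r : ℝ × ℝ →ᵇ ℂ}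
    (hm : IsPer .both m) (hr : IsPer .both r) (z : ℂ) (t : ℝ) :
    (∃ a > 0, SystemBound (HasD .both θ) (mulL .both m) (mulL .both r) z (t * Complex.I) a) ↔
      ∃ a > 0, SystemBound (HasD .first θ) (mulL .first m) (mulL .first r) z 0 a := by
  constructor
  · rintro ⟨a, ha, h⟩
    exact ⟨a, ha, SystemBound.first_of_both hm hr fun s => h.of_irrational hθ s⟩
  · rintro ⟨a, ha, h⟩
    -- Cutting off yields the torus bound at quasi-momentum 0 only; irrationality extends it to all
    -- t.
    refine ⟨a / 8, by positivity, ?_⟩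
    have h1 := h.both_of_first hm hr ha
    have e : (0 : ℂ) = ((0 : ℝ) : ℂ) * Complex.I := by simp
    rw [e] at h1
    exact h1.of_irrational hθ t

/-- The cylinder operator and its Floquet-Bloch fibers have the same spectrum. -/
theorem spectrumOp_opA_eq_opAFiber (θ : ℝ × ℝ) (hθ : Irrational (θ.1 / θ.2)) (μ ρ : ℝ × ℝ → ℝ)
    (hμ_cont : Continuous μ)
    (hμ_per₁ : ∀ y : ℝ × ℝ, μ (y.1 + 1, y.2) = μ y)
    (hμ_per₂ : ∀ y : ℝ × ℝ, μ (y.1, y.2 + 1) = μ y)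
    (hρ_cont : Continuous ρ)
    (hρ_per₁ : ∀ y : ℝ × ℝ, ρ (y.1 + 1, y.2) = ρ y)
    (hρ_per₂ : ∀ y : ℝ × ℝ, ρ (y.1, y.2 + 1) = ρ y)
    (hμ_pos : ∃ c : ℝ, 0 < c ∧ ∀ x : ℝ, c ≤ μ (x • θ))
    (hρ_pos : ∃ c : ℝ, 0 < c ∧ ∀ x : ℝ, c ≤ ρ (x • θ)) (ξ : ℝ) :
    spectrumOp (opA θ μ ρ) = spectrumOp (opAFiber θ μ ρ ξ) := by
  obtain ⟨cμ, hcμ, hμl⟩ := hμ_pos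
  obtain ⟨cρ, hcρ, hρl⟩ := hρ_pos
  -- Positivity is assumed only on ℝθ; density of this line modulo periods extends it to the plane,
  -- so μ⁻¹ is continuous and bounded.
  have hμ := le_of_le_on_line hθ hμ_cont hμ_per₁ hμ_per₂ hμl
  have hρ := le_of_le_on_line hθ hρ_cont hρ_per₁ hρ_per₂ hρl
  obtain ⟨Cμ, hCμ⟩ := exists_abs_le_of_periodic hμ_cont hμ_per₁ hμ_per₂
  obtain ⟨Cρ, hCρ⟩ := exists_abs_le_of_periodic hρ_cont hρ_per₁ hρ_per₂
  have hμ0 : ∀ y, 0 < μ y := fun y => hcμ.trans_le (hμ y)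
  have hρ0 : ∀ y, 0 < ρ y := fun y => hcρ.trans_le (hρ y)
  have hCμ0 : 0 < Cμ := (abs_pos.2 (hμ0 0).ne').trans_le (hCμ 0)
  have hinv : Continuous fun y => (μ y)⁻¹ := hμ_cont.inv₀ fun y => (hμ0 y).ne'
  let m : ℝ × ℝ →ᵇ ℂ := BoundedContinuousFunction.ofNormedAddCommGroup
    (fun y => (((μ y)⁻¹ : ℝ) : ℂ)) (Complex.continuous_ofReal.comp hinv) cμ⁻¹ fun y => by
      rw [Complex.norm_real, Real.norm_of_nonneg (inv_nonneg.2 (hμ0 y).le)]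
      exact inv_anti₀ hcμ (hμ y)
  let r : ℝ × ℝ →ᵇ ℂ := BoundedContinuousFunction.ofNormedAddCommGroup
    (fun y => (ρ y : ℂ)) (Complex.continuous_ofReal.comp hρ_cont) Cρ fun y => by
      rw [Complex.norm_real]
      exact hCρ y
  have hm : ∀ y, m y = (((μ y)⁻¹ : ℝ) : ℂ) := fun _ => rfl
  have hr : ∀ y, r y = (ρ y : ℂ) := fun _ => rfl
  have hmp : IsPer .both m := fun y => by
    rw [hm, hm, eq_fold_of_periodic hμ_per₁ hμ_per₂]
  have hrp : IsPer .both r := fun y => by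
    rw [hr, hr, eq_fold_of_periodic hρ_per₁ hρ_per₂]
  have hmstar : ∀ y, starRingEnd ℂ (m y) = m y := fun y => by rw [hm, Complex.conj_ofReal]
  have hrstar : ∀ y, starRingEnd ℂ (r y) = r y := fun y => by rw [hr, Complex.conj_ofReal]
  -- One positive constant bounding both coefficients from below, as needed for coercivity at the
  -- parameter -1.
  have hml : ∀ y, min Cμ⁻¹ cρ ≤ (μ y)⁻¹ := fun y =>
    (min_le_left _ _).trans (inv_anti₀ (hμ0 y) ((le_abs_self _).trans (hCμ y)))
  have hrl : ∀ y, min Cμ⁻¹ cρ ≤ ρ y := fun y => (min_le_right _ _).trans (hρ y)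
  have hres : ∀ (p : Periodicity) (κ : ℂ), starRingEnd ℂ κ = -κ → ∀ z,
      z ∈ resolventSetOp (op p θ μ ρ κ) ↔
        (∃ a > 0, SystemBound (HasD p θ) (mulL p m) (mulL p r) z κ a) ∧
        ∃ a > 0, SystemBound (HasD p θ) (mulL p m) (mulL p r) (starRingEnd ℂ z) κ a :=
    fun p κ hκ z => mem_resolventSetOp_iff_systemBound (isSkewAdjointRel_hasD p θ)
      (inner_mulL_left hmstar) (inner_mulL_left hrstar) hκ (lt_min (inv_pos.2 hCμ0) hcρ)
      (le_re_inner_mulL hm hml) (le_re_inner_mulL hr hrl)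
      (mem_graph_op_iff (fun y => by rw [hm, Complex.ofReal_inv]) hr (fun y => (hμ0 y).ne')
        fun y => (hρ0 y).ne') z
  have hκ : Complex.I * ξ * θ.2 = ((ξ * θ.2 : ℝ) : ℂ) * Complex.I := by
    push_cast
    ring
  refine congrArg compl (Set.ext fun z => ?_)
  rw [opA, opAFiber, hκ, hres _ _ (by simp), hres _ _ (by simp),
    exists_systemBound_iff hθ hmp hrp, exists_systemBound_iff hθ hmp hrp]

end QuasiPeriodic

end

theorem mainTheorem8 (θ : ℝ × ℝ) (hθ : Irrational (θ.1 / θ.2)) (μ ρ : ℝ × ℝ → ℝ)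
    (hμ_cont : Continuous μ)
    (hμ_per₁ : ∀ y : ℝ × ℝ, μ (y.1 + 1, y.2) = μ y)
    (hμ_per₂ : ∀ y : ℝ × ℝ, μ (y.1, y.2 + 1) = μ y)
    (hρ_cont : Continuous ρ)
    (hρ_per₁ : ∀ y : ℝ × ℝ, ρ (y.1 + 1, y.2) = ρ y)
    (hρ_per₂ : ∀ y : ℝ × ℝ, ρ (y.1, y.2 + 1) = ρ y)
    (hμ_pos : ∃ c : ℝ, 0 < c ∧ ∀ x : ℝ, c ≤ μ (x • θ))
    (hρ_pos : ∃ c : ℝ, 0 < c ∧ ∀ x : ℝ, c ≤ ρ (x • θ)) :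
    (∀ ξ ξ' : ℝ, QuasiPeriodic.spectrumOp (QuasiPeriodic.opAFiber θ μ ρ ξ) =
      QuasiPeriodic.spectrumOp (QuasiPeriodic.opAFiber θ μ ρ ξ')) ∧
    ∀ ξ : ℝ, QuasiPeriodic.spectrumOp (QuasiPeriodic.opA θ μ ρ) =
      QuasiPeriodic.spectrumOp (QuasiPeriodic.opAFiber θ μ ρ ξ) := by
  have h := QuasiPeriodic.spectrumOp_opA_eq_opAFiber θ hθ μ ρ hμ_cont hμ_per₁ hμ_per₂ hρ_cont
    hρ_per₁ hρ_per₂ hμ_pos hρ_pos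
  exact ⟨fun ξ ξ' => (h ξ).symm.trans (h ξ'), h⟩
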